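/- Let $H_3$ be the Heisenberg group, i.e. $\mathbb R^3$ with the product $(x,y,z)(x',y',z')=(x+x',\,y+y',\,z+z'+\tfrac12(xy'-yx'))$, and let $\omega_1=dx$, $\omega_2=dy$, $\omega_3=dz+\tfrac12(y\,dx-x\,dy)$ be its left-invariant coframe. For an integer $k\ge 1$ let $\Lambda_k=\mathbb Z\times\mathbb Z\times\frac1{2k}\mathbb Z\subset H_3$ and $E_k=\Lambda_k\backslash H_3$, a principal circle bundle over $T^2$ via $\Lambda_k(x,y,z)\mapsto (x,y)$, with the action of the circle $(\Lambda_k\cap Z(H_3))\backslash Z(H_3)$. Left-invariant forms on $H_3$ are regarded as (invariant) forms on each $E_k$. Let $C=\{(g,g')\in H_3\times H_3: g=(x,y,z),\ g'=(x,y,z')\}$, with projections $p,p^\vee:C\to H_3$; the correspondence space $E_k\times_{T^2}E_j$ is $((\Lambda_k\times\Lambda_j)\cap C)\backslash C$. Put $\Omega_3=p^*\omega_3$ and $\tilde\Omega_3=p^{\vee*}\omega_3$. Two pairs $(E,H)$, $(E^\vee,H^\vee)$ of principal bundles over the same base $M$, with tori of the same dimension as structure groups, and closed torus-invariant $3$-forms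 are $T$-dual via a $2$-form $F$ on $E\times_M E^\vee$ if $F$ is invariant under both tori, pairs the two torus directions of the fibres non-degenerately, and $p^*H-p^{\vee*}H^\vee=dF$. For nilmanifolds they are invariantly $T$-dual if moreover $H,H^\vee,F$ are induced by left-invariant forms on the covering Lie groups and $H,H^\vee$ vanish whenever two of their arguments are tangent to the torus fibres. Let $H$ be a nonzero left-invariant $3$-form on $H_3$. Then: (1) $H=\lambda\,\omega_1\wedge\omega_2\wedge\omega_3$ for some real $\lambda\ne0$, and for all $j,k\ge1$ the pair $(E_k,H)$ is invariantly $T$-dual to $(E_j,H)$ via $F=\lambda\,\Omega_3\wedge\tilde\Omega_3$. (2) If $j\ne j'$, then the groups $\Lambda_j$ and $\Lambda_{j'}$ are not isomorphic, and the manifolds $E_j$ and $E_{j'}$ are not diffeomorphic. (3) Hence every $(E_k,H)$ has infinitely many pairwise non-diffeomorphic invariant $T$-duals, the $(E_j,H)$ with $j\ge 1$. -/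

import Mathlib

open scoped Manifold ContDiff Topology

noncomputable section

/-! ### Differential forms on manifolds -/

section Forms

variable {E : Type*} [NormedAddCommGroup E] [NormedSpace ℝ E]
  {H : Type*} [TopologicalSpace H] (I : ModelWithCorners ℝ E H)
  {E' : Type*} [NormedAddCommGroup E'] [NormedSpace ℝ E']
  {H' : Type*} [TopologicalSpace H'] (J : ModelWithCorners ℝ E' H')
  {M : Type*} [TopologicalSpace M] [ChartedSpace H M]
  {N : Type*} [TopologicalSpace N] [ChartedSpace H' N]

/-- A (not necessarily smooth) differential `n`-form on the manifold `M`. -/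
abbrev DiffForm (M : Type*) [TopologicalSpace M] [ChartedSpace H M] (n : ℕ) : Type _ :=
  ∀ x : M, TangentSpace I x [⋀^Fin n]→L[ℝ] ℝ

variable {n : ℕ}

/-- The pullback `f^* η` of a differential form. -/
def DiffForm.pullback (f : M → N) (η : DiffForm J N n) : DiffForm I M n :=
  fun x => (η (f x)).compContinuousLinearMap (mfderiv I J f x)

variable {I}

/-- The coordinate expression of `η` in the preferred chart at `x`: the pullback of `η` under the
inverse of that chart, a form on (the range of) the model vector space. -/
def DiffForm.inChart (η : DiffForm I M n) (x : M) : E → E [⋀^Fin n]→L[ℝ] ℝ :=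
  fun u => (η ((extChartAt I x).symm u)).compContinuousLinearMap
    (mfderivWithin 𝓘(ℝ, E) I (extChartAt I x).symm (Set.range I) u)

/-- Smoothness of a differential form, tested in charts. -/
def DiffForm.IsSmooth (η : DiffForm I M n) : Prop :=
  ∀ x : M, ContDiffWithinAt ℝ ∞ (η.inChart x) (Set.range I) (extChartAt I x x)

/-- The exterior derivative of a differential form, computed in charts. -/
def DiffForm.d (η : DiffForm I M n) : DiffForm I M (n + 1) :=
  fun x => (extDerivWithin (η.inChart x) (Set.range I)
    (extChartAt I x x)).compContinuousLinearMap (mfderiv I 𝓘(ℝ, E) (extChartAt I x) x)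

/-- A differential form on a group is left invariant if `L_g^* η = η` for all `g`. -/
def DiffForm.IsLeftInvariant {G : Type*} [Group G] [TopologicalSpace G] [ChartedSpace H G]
    (η : DiffForm I G n) : Prop :=
  ∀ g : G, η.pullback I I (fun h => g * h) = η

end Forms

/-- The wedge product `θ 0 ∧ ⋯ ∧ θ (n - 1)` of covectors:
`(v 0, …, v (n - 1)) ↦ det (θ j (v i))`. -/
def wedgeCovectors {V : Type*} [NormedAddCommGroup V] [NormedSpace ℝ V] {n : ℕ}
    (θ : Fin n → (V →L[ℝ] ℝ)) : V [⋀^Fin n]→L[ℝ] ℝ :=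
  ContinuousAlternatingMap.compContinuousLinearMap
    { (Matrix.detRowAlternating : (Fin n → ℝ) [⋀^Fin n]→ₗ[ℝ] ℝ) with
      cont := Continuous.matrix_det continuous_id }
    (ContinuousLinearMap.pi θ)

/-! ### Principal bundles, correspondence spaces and T-duality -/

section TDuality

/-- `q : P → M` is a smooth principal bundle with structure group the Lie group `T`, acting on `P`
from the right through `act`: the action is smooth, and `M` is covered by open sets `U` with
equivariant diffeomorphisms `U × T → q⁻¹ U` over `U`. -/
structure IsPrincipalBundle
    {EP : Type*} [NormedAddCommGroup EP] [NormedSpace ℝ EP]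
    {HP : Type*} [TopologicalSpace HP] (IP : ModelWithCorners ℝ EP HP)
    {EM : Type*} [NormedAddCommGroup EM] [NormedSpace ℝ EM]
    {HM : Type*} [TopologicalSpace HM] (IM : ModelWithCorners ℝ EM HM)
    {ET : Type*} [NormedAddCommGroup ET] [NormedSpace ℝ ET]
    {HT : Type*} [TopologicalSpace HT] (IT : ModelWithCorners ℝ ET HT)
    {P : Type*} [TopologicalSpace P] [ChartedSpace HP P]
    {M : Type*} [TopologicalSpace M] [ChartedSpace HM M]
    {T : Type*} [TopologicalSpace T] [ChartedSpace HT T] [Group T] [LieGroup IT ∞ T]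
    (q : P → M) (act : P → T → P) : Prop where
  contMDiff_proj : ContMDiff IP IM ∞ q
  contMDiff_act : ContMDiff (IP.prod IT) IP ∞ (fun z : P × T => act z.1 z.2)
  act_one : ∀ e, act e 1 = e
  act_mul : ∀ e s t, act e (s * t) = act (act e s) t
  locally_trivial : ∀ m : M, ∃ (U : Set M) (Φ : PartialDiffeomorph (IM.prod IT) IP (M × T) P ∞),
    IsOpen U ∧ m ∈ U ∧ Φ.source = U ×ˢ Set.univ ∧ Φ.target = q ⁻¹' U ∧
    (∀ u ∈ U, ∀ t, q (Φ (u, t)) = u) ∧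
    (∀ u ∈ U, ∀ s t, Φ (u, s * t) = act (Φ (u, s)) t)

/-- `p₁ : W → E₁` and `p₂ : W → E₂` exhibit the manifold `W` as the fibre product
`E₁ ×_M E₂ = {(a, b) | q₁ a = q₂ b}`, as a submanifold of `E₁ × E₂`. -/
structure IsFibreProduct
    {EV : Type*} [NormedAddCommGroup EV] [NormedSpace ℝ EV]
    {HV : Type*} [TopologicalSpace HV] (IW : ModelWithCorners ℝ EV HV)
    {EA : Type*} [NormedAddCommGroup EA] [NormedSpace ℝ EA]
    {HA : Type*} [TopologicalSpace HA] (I₁ : ModelWithCorners ℝ EA HA)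
    {EB : Type*} [NormedAddCommGroup EB] [NormedSpace ℝ EB]
    {HB : Type*} [TopologicalSpace HB] (I₂ : ModelWithCorners ℝ EB HB)
    {W : Type*} [TopologicalSpace W] [ChartedSpace HV W]
    {P₁ : Type*} [TopologicalSpace P₁] [ChartedSpace HA P₁]
    {P₂ : Type*} [TopologicalSpace P₂] [ChartedSpace HB P₂]
    {M : Type*} (q₁ : P₁ → M) (q₂ : P₂ → M) (p₁ : W → P₁) (p₂ : W → P₂) : Prop where
  isSmoothEmbedding :
    Manifold.IsSmoothEmbedding IW (I₁.prod I₂) ∞ (fun w => (p₁ w, p₂ w))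
  range_eq : Set.range (fun w => (p₁ w, p₂ w)) = {z : P₁ × P₂ | q₁ z.1 = q₂ z.2}

/-- Topological T-duality: `(P₁, H₁)` and `(P₂, H₂)` are T-dual by means of the 2-form `F` on the
correspondence space `W = P₁ ×_M P₂`.  Here `P₁`, `P₂` are principal bundles over `M` whose
structure groups `T₁`, `T₂` are tori (compact connected abelian Lie groups) of the same dimension,
and `H₁`, `H₂` are closed invariant 3-forms. -/
structure IsTDual
    {EV : Type*} [NormedAddCommGroup EV] [NormedSpace ℝ EV]
    {HV : Type*} [TopologicalSpace HV] (IW : ModelWithCorners ℝ EV HV)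
    {EA : Type*} [NormedAddCommGroup EA] [NormedSpace ℝ EA]
    {HA : Type*} [TopologicalSpace HA] (I₁ : ModelWithCorners ℝ EA HA)
    {EB : Type*} [NormedAddCommGroup EB] [NormedSpace ℝ EB]
    {HB : Type*} [TopologicalSpace HB] (I₂ : ModelWithCorners ℝ EB HB)
    {EM : Type*} [NormedAddCommGroup EM] [NormedSpace ℝ EM]
    {HM : Type*} [TopologicalSpace HM] (IM : ModelWithCorners ℝ EM HM)
    {ES : Type*} [NormedAddCommGroup ES] [NormedSpace ℝ ES]
    {HS : Type*} [TopologicalSpace HS] (IT₁ : ModelWithCorners ℝ ES HS)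
    {ET : Type*} [NormedAddCommGroup ET] [NormedSpace ℝ ET]
    {HT : Type*} [TopologicalSpace HT] (IT₂ : ModelWithCorners ℝ ET HT)
    {W : Type*} [TopologicalSpace W] [ChartedSpace HV W] [IsManifold IW ∞ W]
    {P₁ : Type*} [TopologicalSpace P₁] [ChartedSpace HA P₁] [IsManifold I₁ ∞ P₁]
    {P₂ : Type*} [TopologicalSpace P₂] [ChartedSpace HB P₂] [IsManifold I₂ ∞ P₂]
    {M : Type*} [TopologicalSpace M] [ChartedSpace HM M] [IsManifold IM ∞ M]
    {T₁ : Type*} [TopologicalSpace T₁] [ChartedSpace HS T₁] [CommGroup T₁] [LieGroup IT₁ ∞ T₁]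
    [CompactSpace T₁] [ConnectedSpace T₁]
    {T₂ : Type*} [TopologicalSpace T₂] [ChartedSpace HT T₂] [CommGroup T₂] [LieGroup IT₂ ∞ T₂]
    [CompactSpace T₂] [ConnectedSpace T₂]
    (q₁ : P₁ → M) (act₁ : P₁ → T₁ → P₁) (H₁ : DiffForm I₁ P₁ 3)
    (q₂ : P₂ → M) (act₂ : P₂ → T₂ → P₂) (H₂ : DiffForm I₂ P₂ 3)
    (p₁ : W → P₁) (p₂ : W → P₂) (F : DiffForm IW W 2) : Prop where
  finrank_eq : Module.finrank ℝ ES = Module.finrank ℝ ET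
  principal₁ : IsPrincipalBundle I₁ IM IT₁ q₁ act₁
  principal₂ : IsPrincipalBundle I₂ IM IT₂ q₂ act₂
  smooth₁ : H₁.IsSmooth
  smooth₂ : H₂.IsSmooth
  closed₁ : H₁.d = 0
  closed₂ : H₂.d = 0
  torus_invariant₁ : ∀ t, H₁.pullback I₁ I₁ (fun e => act₁ e t) = H₁
  torus_invariant₂ : ∀ t, H₂.pullback I₂ I₂ (fun e => act₂ e t) = H₂
  fibreProduct : IsFibreProduct IW I₁ I₂ q₁ q₂ p₁ p₂
  smooth : F.IsSmooth
  /-- `F` is invariant under the action `a` of each element `(s, t)` of `T₁ × T₂` on `W`. -/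
  torus_invariant : ∀ s t, ∃ a : W → W, ContMDiff IW IW ∞ a ∧
    (∀ w, p₁ (a w) = act₁ (p₁ w) s) ∧ (∀ w, p₂ (a w) = act₂ (p₂ w) t) ∧
    F.pullback IW IW a = F
  /-- `F` is non-degenerate on the fibres: it pairs the directions tangent to the `T₁`-fibres of
  `W` (the kernel of `dp₂`) and those tangent to the `T₂`-fibres (the kernel of `dp₁`)
  non-degenerately. -/
  nondegenerate₁ : ∀ w, ∀ X : TangentSpace IW w, mfderiv IW I₂ p₂ w X = 0 →
    (∀ Y : TangentSpace IW w, mfderiv IW I₁ p₁ w Y = 0 → F w ![X, Y] = 0) → X = 0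
  nondegenerate₂ : ∀ w, ∀ Y : TangentSpace IW w, mfderiv IW I₁ p₁ w Y = 0 →
    (∀ X : TangentSpace IW w, mfderiv IW I₂ p₂ w X = 0 → F w ![X, Y] = 0) → Y = 0
  d_eq : H₁.pullback IW I₁ p₁ - H₂.pullback IW I₂ p₂ = F.d

/-- `α : G → P` exhibits `P` as the nilmanifold `Λ \ G`: `G` is a simply connected nilpotent Lie
group, `Λ` is a discrete cocompact subgroup and `α` is the quotient map. -/
structure IsNilmanifold
    {EG : Type*} [NormedAddCommGroup EG] [NormedSpace ℝ EG]
    {HG : Type*} [TopologicalSpace HG] (IG : ModelWithCorners ℝ EG HG)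
    {EP : Type*} [NormedAddCommGroup EP] [NormedSpace ℝ EP]
    {HP : Type*} [TopologicalSpace HP] (IP : ModelWithCorners ℝ EP HP)
    {G : Type*} [TopologicalSpace G] [ChartedSpace HG G] [Group G] [LieGroup IG ∞ G]
    {P : Type*} [TopologicalSpace P] [ChartedSpace HP P] [IsManifold IP ∞ P]
    (Λ : Subgroup G) (α : G → P) : Prop where
  simplyConnected : SimplyConnectedSpace G
  nilpotent : Group.IsNilpotent G
  discrete : DiscreteTopology Λ
  compact : CompactSpace P
  surjective : Function.Surjective α
  eq_iff : ∀ g h, α g = α h ↔ ∃ l ∈ Λ, l * g = h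
  isLocalDiffeomorph : IsLocalDiffeomorph IG IP ∞ α

/-- A 3-form `H` on the total space of a bundle `q : P → M` is admissible if `H(X, Y, ·) = 0` for
all vectors `X`, `Y` tangent to the fibres. -/
def DiffForm.IsAdmissible
    {EP : Type*} [NormedAddCommGroup EP] [NormedSpace ℝ EP]
    {HP : Type*} [TopologicalSpace HP] {IP : ModelWithCorners ℝ EP HP}
    {EM : Type*} [NormedAddCommGroup EM] [NormedSpace ℝ EM]
    {HM : Type*} [TopologicalSpace HM] (IM : ModelWithCorners ℝ EM HM)
    {P : Type*} [TopologicalSpace P] [ChartedSpace HP P]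
    {M : Type*} [TopologicalSpace M] [ChartedSpace HM M]
    (q : P → M) (η : DiffForm IP P 3) : Prop :=
  ∀ (e : P) (X Y Z : TangentSpace IP e),
    mfderiv IP IM q e X = 0 → mfderiv IP IM q e Y = 0 → η e ![X, Y, Z] = 0

/-- Invariant T-duality of torus bundles which are nilmanifolds: `(P₁, H₁)` and `(P₂, H₂)` are
T-dual by means of `F`, the manifolds `P₁ = Λ₁ \ G₁`, `P₂ = Λ₂ \ G₂` and the correspondence space
`W = Λ \ C` are nilmanifolds, where `C` is a subgroup of `G₁ × G₂` (through the homomorphisms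
`c₁` and `c₂`) and `Λ = (Λ₁ × Λ₂) ∩ C`, the forms `H₁`, `H₂` and `F` are invariant, that is,
induced by left invariant forms on the groups, and `H₁`, `H₂` are admissible. -/
structure IsInvariantlyTDual
    {EC : Type*} [NormedAddCommGroup EC] [NormedSpace ℝ EC]
    {HC : Type*} [TopologicalSpace HC] (IC : ModelWithCorners ℝ EC HC)
    {EG : Type*} [NormedAddCommGroup EG] [NormedSpace ℝ EG]
    {HG : Type*} [TopologicalSpace HG] (IG₁ : ModelWithCorners ℝ EG HG)
    {EG' : Type*} [NormedAddCommGroup EG'] [NormedSpace ℝ EG']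
    {HG' : Type*} [TopologicalSpace HG'] (IG₂ : ModelWithCorners ℝ EG' HG')
    {EV : Type*} [NormedAddCommGroup EV] [NormedSpace ℝ EV]
    {HV : Type*} [TopologicalSpace HV] (IW : ModelWithCorners ℝ EV HV)
    {EA : Type*} [NormedAddCommGroup EA] [NormedSpace ℝ EA]
    {HA : Type*} [TopologicalSpace HA] (I₁ : ModelWithCorners ℝ EA HA)
    {EB : Type*} [NormedAddCommGroup EB] [NormedSpace ℝ EB]
    {HB : Type*} [TopologicalSpace HB] (I₂ : ModelWithCorners ℝ EB HB)
    {EM : Type*} [NormedAddCommGroup EM] [NormedSpace ℝ EM]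
    {HM : Type*} [TopologicalSpace HM] (IM : ModelWithCorners ℝ EM HM)
    {ES : Type*} [NormedAddCommGroup ES] [NormedSpace ℝ ES]
    {HS : Type*} [TopologicalSpace HS] (IT₁ : ModelWithCorners ℝ ES HS)
    {ET : Type*} [NormedAddCommGroup ET] [NormedSpace ℝ ET]
    {HT : Type*} [TopologicalSpace HT] (IT₂ : ModelWithCorners ℝ ET HT)
    {C : Type*} [TopologicalSpace C] [ChartedSpace HC C] [Group C] [LieGroup IC ∞ C]
    {G₁ : Type*} [TopologicalSpace G₁] [ChartedSpace HG G₁] [Group G₁] [LieGroup IG₁ ∞ G₁]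
    {G₂ : Type*} [TopologicalSpace G₂] [ChartedSpace HG' G₂] [Group G₂] [LieGroup IG₂ ∞ G₂]
    {W : Type*} [TopologicalSpace W] [ChartedSpace HV W] [IsManifold IW ∞ W]
    {P₁ : Type*} [TopologicalSpace P₁] [ChartedSpace HA P₁] [IsManifold I₁ ∞ P₁]
    {P₂ : Type*} [TopologicalSpace P₂] [ChartedSpace HB P₂] [IsManifold I₂ ∞ P₂]
    {M : Type*} [TopologicalSpace M] [ChartedSpace HM M] [IsManifold IM ∞ M]
    {T₁ : Type*} [TopologicalSpace T₁] [ChartedSpace HS T₁] [CommGroup T₁] [LieGroup IT₁ ∞ T₁]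
    [CompactSpace T₁] [ConnectedSpace T₁]
    {T₂ : Type*} [TopologicalSpace T₂] [ChartedSpace HT T₂] [CommGroup T₂] [LieGroup IT₂ ∞ T₂]
    [CompactSpace T₂] [ConnectedSpace T₂]
    (Λ₁ : Subgroup G₁) (α₁ : G₁ → P₁) (q₁ : P₁ → M) (act₁ : P₁ → T₁ → P₁) (H₁ : DiffForm I₁ P₁ 3)
    (Λ₂ : Subgroup G₂) (α₂ : G₂ → P₂) (q₂ : P₂ → M) (act₂ : P₂ → T₂ → P₂) (H₂ : DiffForm I₂ P₂ 3)
    (c₁ : C →* G₁) (c₂ : C →* G₂) (γ : C → W)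
    (p₁ : W → P₁) (p₂ : W → P₂) (F : DiffForm IW W 2) : Prop where
  nilmanifold₁ : IsNilmanifold IG₁ I₁ Λ₁ α₁
  nilmanifold₂ : IsNilmanifold IG₂ I₂ Λ₂ α₂
  nilmanifold : IsNilmanifold IC IW (Λ₁.comap c₁ ⊓ Λ₂.comap c₂) γ
  smooth_hom₁ : ContMDiff IC IG₁ ∞ c₁
  smooth_hom₂ : ContMDiff IC IG₂ ∞ c₂
  injective_hom : Function.Injective (fun c => (c₁ c, c₂ c))
  comm₁ : ∀ c, p₁ (γ c) = α₁ (c₁ c)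
  comm₂ : ∀ c, p₂ (γ c) = α₂ (c₂ c)
  tDual : IsTDual IW I₁ I₂ IM IT₁ IT₂ q₁ act₁ H₁ q₂ act₂ H₂ p₁ p₂ F
  admissible₁ : H₁.IsAdmissible IM q₁
  admissible₂ : H₂.IsAdmissible IM q₂
  invariant₁ : (H₁.pullback IG₁ I₁ α₁).IsLeftInvariant
  invariant₂ : (H₂.pullback IG₂ I₂ α₂).IsLeftInvariant
  invariant : (F.pullback IC IW γ).IsLeftInvariant

end TDuality

/-! ### The manifold `Λ \ G` for a discrete subgroup `Λ` -/

section CosetSpace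

/-- The space `Λ \ G` of orbits of `Λ` acting on `G` by left multiplication. -/
abbrev CosetSpace {G : Type*} [Group G] (Λ : Subgroup G) : Type _ :=
  MulAction.orbitRel.Quotient Λ G

/-- The quotient map `G → Λ \ G`. -/
def CosetSpace.proj {G : Type*} [Group G] (Λ : Subgroup G) : G → CosetSpace Λ :=
  Quotient.mk _

instance {G : Type*} [Group G] [TopologicalSpace G] [IsTopologicalGroup G] [T2Space G]
    (Λ : Subgroup G) [DiscreteTopology Λ] : ProperlyDiscontinuousSMul Λ G :=
  Λ.properlyDiscontinuousSMul_of_tendsto_cofinite (Λ.tendsto_coe_cofinite_of_discrete ⟨inferInstance⟩)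

variable {G : Type*} [NormedAddCommGroup G] [NormedSpace ℝ G] [LocallyCompactSpace G]
  [Group G] [IsTopologicalGroup G] [LieGroup 𝓘(ℝ, G) ∞ G]
  (Λ : Subgroup G) [DiscreteTopology Λ]

/-- For a Lie group `G` whose underlying manifold is a vector space, the charted space structure of
`Λ \ G` given by the local inverses of `G → Λ \ G` is that of a smooth manifold. -/
instance CosetSpace.isManifold : IsManifold 𝓘(ℝ, G) ∞ (CosetSpace Λ) := by
  have hloc : IsLocalHomeomorph (Quotient.mk (MulAction.orbitRel Λ G)) :=
    isQuotientCoveringMap_quotientMk_of_properlyDiscontinuousSMul.isCoveringMap.isLocalHomeomorph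
  refine isManifold_of_contDiffOn 𝓘(ℝ, G) ∞ (CosetSpace Λ) ?_
  rintro e e' ⟨a, rfl⟩ ⟨b, rfl⟩
  set g := (Function.Surjective.hasRightInverse
    (Quotient.mk_surjective (s := MulAction.orbitRel Λ G))).choose
  intro y hy
  set φ := hloc.localInverseAt (g a)
  set ψ := hloc.localInverseAt (g b)
  have hφ : φ.symm = Quotient.mk (MulAction.orbitRel Λ G) := hloc.localInverseAt_symm (g a)
  have hψ : ψ.symm = Quotient.mk (MulAction.orbitRel Λ G) := hloc.localInverseAt_symm (g b)
  have hy2 : φ.symm y ∈ ψ.source := by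
    have h2 := hy.1.2
    simp only [chartAt_self_eq] at h2
    exact h2.1
  have hπ : Quotient.mk (MulAction.orbitRel Λ G) (ψ (φ.symm y)) =
      Quotient.mk (MulAction.orbitRel Λ G) y := by
    rw [← congrFun hψ (ψ _), ψ.left_inv hy2, hφ]
  obtain ⟨l, hl⟩ := Quotient.exact hπ
  have hl' : (l : G) * y = ψ (φ.symm y) := hl
  have hsm : ContDiff ℝ ∞ (fun h : G => (l : G) * h) :=
    (contMDiff_mul_left (I := 𝓘(ℝ, G)) (n := ∞) (a := (l : G))).contDiff
  refine (hsm.contDiffAt.congr_of_eventuallyEq ?_).contDiffWithinAt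
  have hmem : ∀ᶠ h in 𝓝 y, (l : G) * h ∈ ψ.target :=
    (hsm.continuous.tendsto y).eventually
      (ψ.open_target.mem_nhds (by rw [hl']; exact ψ.map_source hy2))
  filter_upwards [hmem] with h hh
  have hq : Quotient.mk (MulAction.orbitRel Λ G) h =
      Quotient.mk (MulAction.orbitRel Λ G) ((l : G) * h) :=
    (Quotient.sound (s := MulAction.orbitRel Λ G) ⟨l, rfl⟩ : _ = _).symm
  change ψ (φ.symm h) = (l : G) * h
  rw [hφ, hq, ← congrFun hψ, ψ.right_inv hh]

/-- The form on `Λ \ G` induced by a left invariant form on `G`. -/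
def DiffForm.induced {n : ℕ} (Λ : Subgroup G) [DiscreteTopology Λ] (η : DiffForm 𝓘(ℝ, G) G n) :
    DiffForm 𝓘(ℝ, G) (CosetSpace Λ) n :=
  fun e => (η e.out).compContinuousLinearMap
    (((mfderiv 𝓘(ℝ, G) 𝓘(ℝ, G) (CosetSpace.proj Λ) e.out).inverse :
      TangentSpace 𝓘(ℝ, G) (CosetSpace.proj Λ e.out) →L[ℝ] TangentSpace 𝓘(ℝ, G) e.out) :
      G →L[ℝ] G)

end CosetSpace

/-! ### The Heisenberg group and its lattices -/

/-- The Heisenberg group `H₃`, realized on `ℝ³`. -/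
def Heis : Type := ℝ × ℝ × ℝ

namespace Heis

instance : NormedAddCommGroup Heis := inferInstanceAs (NormedAddCommGroup (ℝ × ℝ × ℝ))
instance : NormedSpace ℝ Heis := inferInstanceAs (NormedSpace ℝ (ℝ × ℝ × ℝ))
instance : ProperSpace Heis := inferInstanceAs (ProperSpace (ℝ × ℝ × ℝ))

def mk (x y z : ℝ) : Heis := (x, y, z)

/-- The coordinate functions, which are linear. -/
def x : Heis →L[ℝ] ℝ := ContinuousLinearMap.fst ℝ ℝ (ℝ × ℝ)
def y : Heis →L[ℝ] ℝ :=
  (ContinuousLinearMap.fst ℝ ℝ ℝ).comp (ContinuousLinearMap.snd ℝ ℝ (ℝ × ℝ))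
def z : Heis →L[ℝ] ℝ :=
  (ContinuousLinearMap.snd ℝ ℝ ℝ).comp (ContinuousLinearMap.snd ℝ ℝ (ℝ × ℝ))

@[simp] theorem x_mk (a b c : ℝ) : x (mk a b c) = a := rfl
@[simp] theorem y_mk (a b c : ℝ) : y (mk a b c) = b := rfl
@[simp] theorem z_mk (a b c : ℝ) : z (mk a b c) = c := rfl

@[ext] theorem ext {g h : Heis} (hx : x g = x h) (hy : y g = y h) (hz : z g = z h) : g = h :=
  Prod.ext hx (Prod.ext hy hz)

theorem contDiff_mk {V : Type*} [NormedAddCommGroup V] [NormedSpace ℝ V] {a b c : V → ℝ}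
    (ha : ContDiff ℝ ∞ a) (hb : ContDiff ℝ ∞ b) (hc : ContDiff ℝ ∞ c) :
    ContDiff ℝ ∞ (fun v => mk (a v) (b v) (c v)) :=
  ha.prodMk (hb.prodMk hc)

/-- `(x, y, z) (x', y', z') = (x + x', y + y', z + z' + (x y' - y x') / 2)`. -/
instance : Group Heis where
  mul g h := mk (x g + x h) (y g + y h) (z g + z h + (x g * y h - y g * x h) / 2)
  one := mk 0 0 0
  inv g := mk (-x g) (-y g) (-z g)
  mul_assoc g h k := by
    apply ext
    · exact add_assoc _ _ _
    · exact add_assoc _ _ _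
    · change (z g + z h + (x g * y h - y g * x h) / 2) + z k
        + ((x g + x h) * y k - (y g + y h) * x k) / 2
        = z g + (z h + z k + (x h * y k - y h * x k) / 2)
        + (x g * (y h + y k) - y g * (x h + x k)) / 2
      ring
  one_mul g := by
    apply ext
    · exact zero_add _
    · exact zero_add _
    · change 0 + z g + (0 * y g - 0 * x g) / 2 = z g
      ring
  mul_one g := by
    apply ext
    · exact add_zero _
    · exact add_zero _
    · change z g + 0 + (x g * 0 - y g * 0) / 2 = z g
      ring
  inv_mul_cancel g := by
    apply ext
    · exact neg_add_cancel _
    · exact neg_add_cancel _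
    · change -z g + z g + (-x g * y g - -y g * x g) / 2 = 0
      ring

theorem mul_def (g h : Heis) :
    g * h = mk (x g + x h) (y g + y h) (z g + z h + (x g * y h - y g * x h) / 2) := rfl
theorem one_def : (1 : Heis) = mk 0 0 0 := rfl
theorem inv_def (g : Heis) : g⁻¹ = mk (-x g) (-y g) (-z g) := rfl

theorem contDiff_mul : ContDiff ℝ ∞ (fun p : Heis × Heis => p.1 * p.2) :=
  contDiff_mk (by fun_prop) (by fun_prop) (by fun_prop)

theorem contDiff_inv : ContDiff ℝ ∞ (fun p : Heis => p⁻¹) :=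
  contDiff_mk (by fun_prop) (by fun_prop) (by fun_prop)

instance : LieGroup 𝓘(ℝ, Heis) ∞ Heis where
  contMDiff_mul := by
    convert! contDiff_mul.contMDiff using 2
    · exact modelWithCornersSelf_prod.symm
    · exact chartedSpaceSelf_prod
  contMDiff_inv := contDiff_inv.contMDiff

instance : IsTopologicalGroup Heis := topologicalGroup_of_lieGroup 𝓘(ℝ, Heis) ∞

/-- The left invariant coframe: `ω₁ = dx`, `ω₂ = dy`, `ω₃ = dz + (y dx - x dy) / 2`. -/
def coframe (g : Heis) : Fin 3 → (Heis →L[ℝ] ℝ) :=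
  ![x, y, z + (1 / 2 : ℝ) • (y g • x - x g • y)]

/-- The 3-form `ω₁ ∧ ω₂ ∧ ω₃`. -/
def vol : DiffForm 𝓘(ℝ, Heis) Heis 3 :=
  fun g => (wedgeCovectors (coframe g) : Heis [⋀^Fin 3]→L[ℝ] ℝ)

/-- The lattice `Λ_k = ℤ × ℤ × (1 / 2k) ℤ`. -/
def lattice (k : ℕ+) : Subgroup Heis where
  carrier := {g | (∃ a : ℤ, x g = a) ∧ (∃ b : ℤ, y g = b) ∧ ∃ c : ℤ, z g = c / (2 * (k : ℕ))}
  one_mem' := ⟨⟨0, by simp [one_def]⟩, ⟨0, by simp [one_def]⟩, ⟨0, by simp [one_def]⟩⟩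
  mul_mem' := by
    rintro g h ⟨⟨a, ha⟩, ⟨b, hb⟩, c, hc⟩ ⟨⟨a', ha'⟩, ⟨b', hb'⟩, c', hc'⟩
    have hk : ((k : ℕ) : ℝ) ≠ 0 := by exact_mod_cast k.ne_zero
    refine ⟨⟨a + a', by simp [mul_def, ha, ha']⟩, ⟨b + b', by simp [mul_def, hb, hb']⟩,
      ⟨c + c' + (a * b' - b * a') * (k : ℕ), ?_⟩⟩
    simp only [mul_def, z_mk, ha, hb, hc, ha', hb', hc']
    push_cast
    field_simp
  inv_mem' := by
    rintro g ⟨⟨a, ha⟩, ⟨b, hb⟩, c, hc⟩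
    exact ⟨⟨-a, by simp [inv_def, ha]⟩, ⟨-b, by simp [inv_def, hb]⟩,
      ⟨-c, by simp [inv_def, hc, neg_div]⟩⟩

theorem mem_lattice {k : ℕ+} {g : Heis} : g ∈ lattice k ↔
    (∃ a : ℤ, x g = a) ∧ (∃ b : ℤ, y g = b) ∧ ∃ c : ℤ, z g = c / (2 * (k : ℕ)) := Iff.rfl

/-- The lattice points other than `1` stay away from `1`. -/
theorem eq_one_of_mem_lattice {k : ℕ+} {g : Heis} (hg : g ∈ lattice k) (hx : |x g| < 1)
    (hy : |y g| < 1) (hz : |z g| < 1 / (2 * (k : ℕ))) : g = 1 := by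
  obtain ⟨⟨a, ha⟩, ⟨b, hb⟩, c, hc⟩ := hg
  have hk : (0 : ℝ) < 2 * (k : ℕ) := by
    have : (0 : ℝ) < (k : ℕ) := by exact_mod_cast k.pos
    linarith
  have int0 : ∀ m : ℤ, |(m : ℝ)| < 1 → m = 0 := fun m hm => by
    rw [← Int.abs_lt_one_iff]
    exact_mod_cast hm
  have ha0 := int0 a (by rwa [← ha])
  have hb0 := int0 b (by rwa [← hb])
  have hc0 := int0 c (by rwa [hc, abs_div, abs_of_pos hk, div_lt_div_iff_of_pos_right hk] at hz)
  apply ext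
  · simp [ha, ha0, one_def]
  · simp [hb, hb0, one_def]
  · simp [hc, hc0, one_def]

instance (k : ℕ+) : DiscreteTopology (lattice k) := by
  have hk : (0 : ℝ) < 1 / (2 * (k : ℕ)) := by
    have : (0 : ℝ) < (k : ℕ) := by exact_mod_cast k.pos
    positivity
  rw [discreteTopology_iff_isOpen_singleton_one]
  refine ⟨{g : Heis | |x g| < 1 ∧ |y g| < 1 ∧ |z g| < 1 / (2 * (k : ℕ))}, ?_, ?_⟩
  · exact (isOpen_lt x.continuous.abs continuous_const).inter
      ((isOpen_lt y.continuous.abs continuous_const).inter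
        (isOpen_lt z.continuous.abs continuous_const))
  · ext ⟨g, hg⟩
    constructor
    · rintro ⟨h1, h2, h3⟩
      exact Subtype.ext (eq_one_of_mem_lattice hg h1 h2 h3)
    · intro h
      have h' : g = 1 := congrArg Subtype.val h
      subst h'
      simp [one_def]

/-- The bundle projection `E_k = Λ_k \ H₃ → T² = S¹ × S¹`,
`Λ_k (x, y, z) ↦ (exp (2 π i x), exp (2 π i y))`. -/
def toTorus (k : ℕ+) : CosetSpace (lattice k) → Circle × Circle :=
  Quotient.lift (fun g : Heis => (Circle.exp (2 * Real.pi * x g), Circle.exp (2 * Real.pi * y g)))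
    (by
      rintro g h ⟨⟨l, ⟨a, ha⟩, ⟨b, hb⟩, -⟩, rfl⟩
      have hx : x (l * h) = x h + a := by simp [mul_def, ha, add_comm]
      have hy : y (l * h) = y h + b := by simp [mul_def, hb, add_comm]
      have hp : ∀ (r : ℝ) (m : ℤ),
          Circle.exp (2 * Real.pi * (r + m)) = Circle.exp (2 * Real.pi * r) := fun r m => by
        rw [mul_add, Circle.exp_add, mul_comm (2 * Real.pi) (m : ℝ), Circle.exp_int_mul_two_pi,
          mul_one]
      change (Circle.exp (2 * Real.pi * x (l * h)), Circle.exp (2 * Real.pi * y (l * h))) = _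
      rw [hx, hy, hp, hp])

/-- The principal action of `S¹` on `E_k`: identifying `(Λ_k ∩ A) \ A`, where `A` is the center
`{(0, 0, z)}` of `H₃`, with `S¹` through `(0, 0, z) ↦ exp (2 π i (2 k z))`, the element
`exp (2 π i s)` maps `Λ_k g` to `Λ_k (g (0, 0, s / 2k))`. -/
def circleAct (k : ℕ+) (e : CosetSpace (lattice k)) (t : Circle) : CosetSpace (lattice k) :=
  Quotient.map (fun g : Heis => g * mk 0 0 (Complex.arg t / (2 * Real.pi) / (2 * (k : ℕ))))
    (by
      rintro g h ⟨l, rfl⟩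
      exact ⟨l, (mul_assoc (l : Heis) h _).symm⟩) e

end Heis

/-- The group `C = {(g, g') ∈ H₃ × H₃ | g = (x, y, z), g' = (x, y, z')}`, in the coordinates
`(x, y, z, z')`. -/
def CorrGroup : Type := ℝ × ℝ × ℝ × ℝ

namespace CorrGroup

instance : NormedAddCommGroup CorrGroup := inferInstanceAs (NormedAddCommGroup (ℝ × ℝ × ℝ × ℝ))
instance : NormedSpace ℝ CorrGroup := inferInstanceAs (NormedSpace ℝ (ℝ × ℝ × ℝ × ℝ))
instance : ProperSpace CorrGroup := inferInstanceAs (ProperSpace (ℝ × ℝ × ℝ × ℝ))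

def mk (x y z z' : ℝ) : CorrGroup := (x, y, z, z')

/-- `(x, y, z, z') ↦ (x, y, z)`. -/
def fst : CorrGroup →L[ℝ] Heis :=
  (ContinuousLinearMap.fst ℝ ℝ (ℝ × ℝ × ℝ)).prod
    (((ContinuousLinearMap.fst ℝ ℝ (ℝ × ℝ)).comp (ContinuousLinearMap.snd ℝ ℝ (ℝ × ℝ × ℝ))).prod
      ((ContinuousLinearMap.fst ℝ ℝ ℝ).comp ((ContinuousLinearMap.snd ℝ ℝ (ℝ × ℝ)).comp
        (ContinuousLinearMap.snd ℝ ℝ (ℝ × ℝ × ℝ)))))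

/-- `(x, y, z, z') ↦ (x, y, z')`. -/
def snd : CorrGroup →L[ℝ] Heis :=
  (ContinuousLinearMap.fst ℝ ℝ (ℝ × ℝ × ℝ)).prod
    (((ContinuousLinearMap.fst ℝ ℝ (ℝ × ℝ)).comp (ContinuousLinearMap.snd ℝ ℝ (ℝ × ℝ × ℝ))).prod
      ((ContinuousLinearMap.snd ℝ ℝ ℝ).comp ((ContinuousLinearMap.snd ℝ ℝ (ℝ × ℝ)).comp
        (ContinuousLinearMap.snd ℝ ℝ (ℝ × ℝ × ℝ)))))

@[simp] theorem fst_mk (a b c d : ℝ) : fst (mk a b c d) = Heis.mk a b c := rfl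
@[simp] theorem snd_mk (a b c d : ℝ) : snd (mk a b c d) = Heis.mk a b d := rfl

theorem mk_eta (g : CorrGroup) :
    mk (Heis.x (fst g)) (Heis.y (fst g)) (Heis.z (fst g)) (Heis.z (snd g)) = g := rfl

@[ext] theorem ext {g h : CorrGroup} (h₁ : fst g = fst h) (h₂ : snd g = snd h) : g = h := by
  rw [← mk_eta g, ← mk_eta h, h₁, h₂]

theorem contDiff_mk {V : Type*} [NormedAddCommGroup V] [NormedSpace ℝ V] {a b c d : V → ℝ}
    (ha : ContDiff ℝ ∞ a) (hb : ContDiff ℝ ∞ b) (hc : ContDiff ℝ ∞ c) (hd : ContDiff ℝ ∞ d) :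
    ContDiff ℝ ∞ (fun v => mk (a v) (b v) (c v) (d v)) :=
  ha.prodMk (hb.prodMk (hc.prodMk hd))

/-- The element of `C` given by a pair of elements of `H₃`, the first two coordinates being those of
the first element. -/
def ofPair (g g' : Heis) : CorrGroup := mk (Heis.x g) (Heis.y g) (Heis.z g) (Heis.z g')

/-- `C` has the componentwise group structure of `H₃ × H₃`. -/
instance : Group CorrGroup where
  mul g h := ofPair (fst g * fst h) (snd g * snd h)
  one := ofPair 1 1
  inv g := ofPair (fst g)⁻¹ (snd g)⁻¹
  mul_assoc g h k := by
    apply ext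
    · exact mul_assoc (fst g) (fst h) (fst k)
    · exact mul_assoc (snd g) (snd h) (snd k)
  one_mul g := by
    apply ext
    · exact one_mul (fst g)
    · exact one_mul (snd g)
  mul_one g := by
    apply ext
    · exact mul_one (fst g)
    · exact mul_one (snd g)
  inv_mul_cancel g := by
    apply ext
    · exact inv_mul_cancel (fst g)
    · exact inv_mul_cancel (snd g)

/-- The projections `C → H₃`, as group homomorphisms. -/
def fstHom : CorrGroup →* Heis where
  toFun := fst
  map_one' := rfl
  map_mul' _ _ := rfl

def sndHom : CorrGroup →* Heis where
  toFun := snd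
  map_one' := rfl
  map_mul' _ _ := rfl

instance : LieGroup 𝓘(ℝ, CorrGroup) ∞ CorrGroup where
  contMDiff_mul := by
    have h : ContDiff ℝ ∞ (fun p : CorrGroup × CorrGroup => p.1 * p.2) :=
      have h₁ : ContDiff ℝ ∞ (fun p : CorrGroup × CorrGroup => fst p.1 * fst p.2) :=
        Heis.contDiff_mul.comp ((fst.contDiff.comp contDiff_fst).prodMk
          (fst.contDiff.comp contDiff_snd))
      have h₂ : ContDiff ℝ ∞ (fun p : CorrGroup × CorrGroup => snd p.1 * snd p.2) :=
        Heis.contDiff_mul.comp ((snd.contDiff.comp contDiff_fst).prodMk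
          (snd.contDiff.comp contDiff_snd))
      contDiff_mk (Heis.x.contDiff.comp h₁) (Heis.y.contDiff.comp h₁) (Heis.z.contDiff.comp h₁)
        (Heis.z.contDiff.comp h₂)
    convert! h.contMDiff using 2
    · exact modelWithCornersSelf_prod.symm
    · exact chartedSpaceSelf_prod
  contMDiff_inv := by
    have h₁ : ContDiff ℝ ∞ (fun p : CorrGroup => (fst p)⁻¹) :=
      Heis.contDiff_inv.comp fst.contDiff
    have h₂ : ContDiff ℝ ∞ (fun p : CorrGroup => (snd p)⁻¹) :=
      Heis.contDiff_inv.comp snd.contDiff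
    exact ContDiff.contMDiff (contDiff_mk (Heis.x.contDiff.comp h₁) (Heis.y.contDiff.comp h₁)
      (Heis.z.contDiff.comp h₁) (Heis.z.contDiff.comp h₂))

instance : IsTopologicalGroup CorrGroup := topologicalGroup_of_lieGroup 𝓘(ℝ, CorrGroup) ∞

/-- The lattice `(Λ_k × Λ_j) ∩ C`. -/
def lattice (k j : ℕ+) : Subgroup CorrGroup :=
  (Heis.lattice k).comap fstHom ⊓ (Heis.lattice j).comap sndHom

instance (k j : ℕ+) : DiscreteTopology (lattice k j) := by
  have hk : (0 : ℝ) < 1 / (2 * (k : ℕ)) := by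
    have : (0 : ℝ) < (k : ℕ) := by exact_mod_cast k.pos
    positivity
  have hj : (0 : ℝ) < 1 / (2 * (j : ℕ)) := by
    have : (0 : ℝ) < (j : ℕ) := by exact_mod_cast j.pos
    positivity
  rw [discreteTopology_iff_isOpen_singleton_one]
  refine ⟨{g : CorrGroup | |Heis.x (fst g)| < 1 ∧ |Heis.y (fst g)| < 1 ∧
    |Heis.z (fst g)| < 1 / (2 * (k : ℕ)) ∧ |Heis.z (snd g)| < 1 / (2 * (j : ℕ))}, ?_, ?_⟩
  · exact (isOpen_lt (Heis.x.comp fst).continuous.abs continuous_const).inter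
      ((isOpen_lt (Heis.y.comp fst).continuous.abs continuous_const).inter
        ((isOpen_lt (Heis.z.comp fst).continuous.abs continuous_const).inter
          (isOpen_lt (Heis.z.comp snd).continuous.abs continuous_const)))
  · ext ⟨g, hg⟩
    constructor
    · rintro ⟨h1, h2, h3, h4⟩
      exact Subtype.ext (ext (Heis.eq_one_of_mem_lattice hg.1 h1 h2 h3)
        (Heis.eq_one_of_mem_lattice hg.2 h1 h2 h4))
    · intro h
      have h' : g = 1 := congrArg Subtype.val h
      subst h'
      have e₁ : fst 1 = 1 := rfl
      have e₂ : snd 1 = 1 := rfl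
      simp [e₁, e₂, Heis.one_def]

/-- The projections of the correspondence space `((Λ_k × Λ_j) ∩ C) \ C` to `E_k` and `E_j`. -/
def toLeft (k j : ℕ+) : CosetSpace (lattice k j) → CosetSpace (Heis.lattice k) :=
  Quotient.map fst (by
    rintro g h ⟨l, rfl⟩
    exact ⟨⟨fst l, l.2.1⟩, rfl⟩)

def toRight (k j : ℕ+) : CosetSpace (lattice k j) → CosetSpace (Heis.lattice j) :=
  Quotient.map snd (by
    rintro g h ⟨l, rfl⟩
    exact ⟨⟨snd l, l.2.2⟩, rfl⟩)

/-- The 2-form `Ω₃ ∧ Ω̃₃` on `C`, where `Ω₃` and `Ω̃₃` are the pullbacks of `ω₃` under the two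
projections `C → H₃`. -/
def fibreForm : DiffForm 𝓘(ℝ, CorrGroup) CorrGroup 2 :=
  fun g => (wedgeCovectors ![(Heis.coframe (fst g) 2).comp fst, (Heis.coframe (snd g) 2).comp snd] :
    CorrGroup [⋀^Fin 2]→L[ℝ] ℝ)

end CorrGroup

/-! ### The nilmanifolds `E_k` and their T-duality -/

/-- The Heisenberg nilmanifold `E_k = Λ_k \ H₃`. -/
abbrev HeisNil (k : ℕ+) : Type := CosetSpace (Heis.lattice k)

/-- The correspondence space `((Λ_k × Λ_j) ∩ C) \ C` of `E_k` and `E_j`. -/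
abbrev HeisCorr (k j : ℕ+) : Type := CosetSpace (CorrGroup.lattice k j)

/-- `(E_k, H₁)` and `(E_j, H₂)`, as circle bundles over `T²`, are invariantly T-dual by means of the
2-form `F` on the correspondence space. -/
def HeisNil.TDualVia (k j : ℕ+) (H₁ : DiffForm 𝓘(ℝ, Heis) (HeisNil k) 3)
    (H₂ : DiffForm 𝓘(ℝ, Heis) (HeisNil j) 3)
    (F : DiffForm 𝓘(ℝ, CorrGroup) (HeisCorr k j) 2) : Prop :=
  IsInvariantlyTDual 𝓘(ℝ, CorrGroup) 𝓘(ℝ, Heis) 𝓘(ℝ, Heis)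
    𝓘(ℝ, CorrGroup) 𝓘(ℝ, Heis) 𝓘(ℝ, Heis) ((𝓡 1).prod (𝓡 1)) (𝓡 1) (𝓡 1)
    (Heis.lattice k) (CosetSpace.proj (Heis.lattice k)) (Heis.toTorus k) (Heis.circleAct k) H₁
    (Heis.lattice j) (CosetSpace.proj (Heis.lattice j)) (Heis.toTorus j) (Heis.circleAct j) H₂
    CorrGroup.fstHom CorrGroup.sndHom (CosetSpace.proj (CorrGroup.lattice k j))
    (CorrGroup.toLeft k j) (CorrGroup.toRight k j) F

end

/-!
All forms involved are computed on the covering groups. The inverse of every preferred chart of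
`Λ \ G` is the quotient map `G → Λ \ G` itself, so a form on `Λ \ G` is determined by its pullback to
`G` (`CosetSpace.eq_of_pullback_eq`), is smooth if this pullback is, and has its exterior derivative
computed by that of the pullback (`CosetSpace.d_eq_of_pullback`). The form induced by a left
invariant form pulls back to that form (`CosetSpace.pullback_proj_induced`), and it is invariant
under the maps covered by translations by central elements, since these are also left translations
(`CosetSpace.pullback_eq_of_central`); this gives invariance under the torus actions.

A left invariant 3-form on the Heisenberg group is determined by its value at `1`, hence a multiple
of `ω₁ ∧ ω₂ ∧ ω₃ = dx ∧ dy ∧ dz`, which has constant coefficients and is closed. On the group `C`,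
the coefficients of `Ω₃ ∧ Ω̃₃` are affine functions of the coordinates, and `dω₃ = - ω₁ ∧ ω₂` takes the
form `d(Ω₃ ∧ Ω̃₃) = p^*(ω₁ ∧ ω₂ ∧ ω₃) - p^∨^*(ω₁ ∧ ω₂ ∧ ω₃)` (`CorrGroup.extDeriv_smul_fibreForm`).
The bundles `E_k → T²` are trivialized by means of local logarithms on the circle
(`Heis.isPrincipalBundle`), and the correspondence space embeds into `E_k × E_j` as the fibre product
(`CorrGroup.isFibreProduct`). Together this yields the T-duality `HeisNil.tDualVia_vol`.

To tell the `E_k` apart: a homeomorphism `E_i → E_j` lifts to the simply connected group `H₃`, and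
the lift intertwines the deck transformations, so `Λ_i` and `Λ_j` are isomorphic
(`CosetSpace.nonempty_mulEquiv_of_homeomorph`). The center of `Λ_k` is `{(0, 0, c / 2k) | c ∈ ℤ}` and
its commutator subgroup is `{(0, 0, c) | c ∈ ℤ}`, so the exponent `2k` of the quotient is an
invariant of the group (`Heis.forall_center_pow_mem_commutator_iff`).
-/

noncomputable section

set_option linter.unusedSectionVars false

/-! ### Pullbacks of differential forms -/

namespace DiffForm

variable {E : Type*} [NormedAddCommGroup E] [NormedSpace ℝ E]
  {H : Type*} [TopologicalSpace H] {I : ModelWithCorners ℝ E H}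
  {E' : Type*} [NormedAddCommGroup E'] [NormedSpace ℝ E']
  {H' : Type*} [TopologicalSpace H'] {J : ModelWithCorners ℝ E' H'}
  {E'' : Type*} [NormedAddCommGroup E''] [NormedSpace ℝ E'']
  {H'' : Type*} [TopologicalSpace H''] {K : ModelWithCorners ℝ E'' H''}
  {M : Type*} [TopologicalSpace M] [ChartedSpace H M]
  {N : Type*} [TopologicalSpace N] [ChartedSpace H' N]
  {P : Type*} [TopologicalSpace P] [ChartedSpace H'' P] {n : ℕ}

theorem pullback_congr_at (η : DiffForm J N n) {f f' : M → N} {x : M} (h : f =ᶠ[𝓝 x] f') :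
    η.pullback I J f x = η.pullback I J f' x := by
  have key : ∀ (y y' : N) (_ : y = y') (A A' : E →L[ℝ] E') (_ : A = A'),
      ((η y : E' [⋀^Fin n]→L[ℝ] ℝ).compContinuousLinearMap A) =
      ((η y' : E' [⋀^Fin n]→L[ℝ] ℝ).compContinuousLinearMap A') := by
    rintro y _ rfl A _ rfl
    rfl
  exact key _ _ h.eq_of_nhds _ _ h.mfderiv_eq

theorem pullback_id (η : DiffForm I M n) : η.pullback I I id = η := by
  funext x
  have h : mfderiv I I (id : M → M) x = ContinuousLinearMap.id ℝ (TangentSpace I x) := mfderiv_id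
  ext v
  change η x (fun i => mfderiv I I (id : M → M) x (v i)) = η x v
  rw [h]
  rfl

theorem pullback_pullback_at (η : DiffForm K P n) {g : N → P} {f : M → N} {x : M}
    (hg : MDifferentiableAt J K g (f x)) (hf : MDifferentiableAt I J f x) :
    (η.pullback J K g).pullback I J f x = η.pullback I K (g ∘ f) x := by
  ext v
  change η (g (f x)) (fun i => mfderiv J K g (f x) (mfderiv I J f x (v i))) =
    η (g (f x)) (fun i => mfderiv I K (g ∘ f) x (v i))
  rw [mfderiv_comp x hg hf]
  rfl

theorem pullback_pullback (η : DiffForm K P n) {g : N → P} {f : M → N}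
    (hg : MDifferentiable J K g) (hf : MDifferentiable I J f) :
    (η.pullback J K g).pullback I J f = η.pullback I K (g ∘ f) :=
  funext fun _ => pullback_pullback_at η (hg _) (hf _)

end DiffForm

/-! ### The quotient map `G → Λ \ G` and forms on `Λ \ G` -/

namespace CosetSpace

section Group

variable {G : Type*} [Group G] {Λ : Subgroup G}

theorem proj_eq_proj {g h : G} : proj Λ g = proj Λ h ↔ ∃ l ∈ Λ, l * g = h := by
  constructor
  · intro e
    obtain ⟨l, hl⟩ := Quotient.exact e
    exact ⟨(l : G)⁻¹, inv_mem l.2, by rw [← hl]; exact inv_mul_cancel_left (l : G) h⟩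
  · rintro ⟨l, hl, rfl⟩
    exact (Quotient.sound (s := MulAction.orbitRel Λ G) ⟨⟨l, hl⟩, rfl⟩ : _ = _).symm

theorem proj_mul {l : G} (hl : l ∈ Λ) (g : G) : proj Λ (l * g) = proj Λ g :=
  (proj_eq_proj.2 ⟨l, hl, rfl⟩).symm

theorem proj_surjective : Function.Surjective (proj Λ) := Quotient.mk_surjective

end Group

section Lie

variable {G : Type*} [NormedAddCommGroup G] [NormedSpace ℝ G] [LocallyCompactSpace G]
  [Group G] [IsTopologicalGroup G] [LieGroup 𝓘(ℝ, G) ∞ G]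
  (Λ : Subgroup G) [DiscreteTopology Λ]

theorem isQuotientCoveringMap_proj : IsQuotientCoveringMap (proj Λ) Λ :=
  isQuotientCoveringMap_quotientMk_of_properlyDiscontinuousSMul

variable {Λ}

/-- The inverse of a preferred chart of `Λ \ G` is the quotient map. -/
theorem coe_chartAt_symm (x : CosetSpace Λ) : ⇑(chartAt G x).symm = proj Λ :=
  (isQuotientCoveringMap_proj Λ).isCoveringMap.isLocalHomeomorph.localInverseAt_symm _

theorem coe_extChartAt_symm (x : CosetSpace Λ) : ⇑(extChartAt 𝓘(ℝ, G) x).symm = proj Λ := by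
  rw [← coe_chartAt_symm x]
  rfl

theorem proj_chartAt {x y : CosetSpace Λ} (hy : y ∈ (chartAt G x).source) :
    proj Λ (chartAt G x y) = y := by
  rw [← coe_chartAt_symm x, (chartAt G x).left_inv hy]

theorem contMDiffAt_chartAt (x : CosetSpace Λ) :
    ContMDiffAt 𝓘(ℝ, G) 𝓘(ℝ, G) ∞ (chartAt G x) x :=
  contMDiffAt_extChartAt

/-- The inverse of the preferred chart at a point of `Λ \ G`, as a local diffeomorphism. -/
def chartSymmDiffeo (x : CosetSpace Λ) :
    PartialDiffeomorph 𝓘(ℝ, G) 𝓘(ℝ, G) G (CosetSpace Λ) ∞ where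
  toPartialEquiv := (chartAt G x).symm.toPartialEquiv
  open_source := (chartAt G x).open_target
  open_target := (chartAt G x).open_source
  contMDiffOn_toFun := contMDiffOn_chart_symm (I := 𝓘(ℝ, G)) (n := ∞)
  contMDiffOn_invFun := contMDiffOn_chart (I := 𝓘(ℝ, G)) (n := ∞)

variable (Λ) in
theorem isLocalDiffeomorph_proj : IsLocalDiffeomorph 𝓘(ℝ, G) 𝓘(ℝ, G) ∞ (proj Λ) := by
  intro g
  set x := proj Λ g
  obtain ⟨l, hl, hlg⟩ := proj_eq_proj.1 (proj_chartAt (mem_chart_source G x)).symm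
  -- `proj` is the composition of translation by `l` and the inverse of the chart at `proj g`.
  have h1 : IsLocalDiffeomorphAt 𝓘(ℝ, G) 𝓘(ℝ, G) ∞ (proj Λ) (l * g) := by
    refine ⟨chartSymmDiffeo x, ?_, fun y _ => ?_⟩
    · rw [hlg]
      exact mem_chart_target G x
    · exact (congrFun (coe_chartAt_symm x) y).symm
  let T : Diffeomorph 𝓘(ℝ, G) 𝓘(ℝ, G) G G ∞ :=
    { Equiv.mulLeft l with
      contMDiff_toFun := contMDiff_mul_left
      contMDiff_invFun := contMDiff_mul_left }
  have h2 : IsLocalDiffeomorphAt 𝓘(ℝ, G) 𝓘(ℝ, G) ∞ (proj Λ ∘ T) g :=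
    (T.isLocalDiffeomorph g).comp _ _ h1
  have h3 : proj Λ ∘ T = proj Λ := funext fun y => proj_mul hl y
  rwa [h3] at h2

variable (Λ) in
theorem contMDiff_proj : ContMDiff 𝓘(ℝ, G) 𝓘(ℝ, G) ∞ (proj Λ) :=
  (isLocalDiffeomorph_proj Λ).contMDiff

variable (Λ) in
theorem mdifferentiable_proj : MDifferentiable 𝓘(ℝ, G) 𝓘(ℝ, G) (proj Λ) :=
  (contMDiff_proj Λ).mdifferentiable (by simp)

/-- The derivative of the quotient map `G → Λ \ G`, as a linear isomorphism. -/
def projDeriv (g : G) : G ≃L[ℝ] G :=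
  (isLocalDiffeomorph_proj Λ).mfderivToContinuousLinearEquiv (by simp) g

theorem coe_projDeriv (g : G) : (projDeriv (Λ := Λ) g : G →L[ℝ] G) =
    mfderiv 𝓘(ℝ, G) 𝓘(ℝ, G) (proj Λ) g :=
  (isLocalDiffeomorph_proj Λ).mfderivToContinuousLinearEquiv_coe (by simp) g

theorem projDeriv_apply (g v : G) : projDeriv (Λ := Λ) g v =
    (mfderiv 𝓘(ℝ, G) 𝓘(ℝ, G) (proj Λ) g : G →L[ℝ] G) v := by
  rw [← coe_projDeriv]; rfl

variable {n : ℕ}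

/-- The inverse of the preferred chart is the restriction of `G → Λ \ G`, so the coordinate
expression of a form on `Λ \ G` is, in every preferred chart, its pullback to `G`. -/
theorem inChart_eq (η : DiffForm 𝓘(ℝ, G) (CosetSpace Λ) n) (x : CosetSpace Λ) :
    η.inChart x = η.pullback 𝓘(ℝ, G) 𝓘(ℝ, G) (proj Λ) := by
  funext u
  have h := coe_extChartAt_symm x
  unfold DiffForm.inChart DiffForm.pullback
  rw [modelWithCornersSelf_coe, Set.range_id, mfderivWithin_univ, h]
  rfl

/-- Smoothness of a form on `Λ \ G` can be tested on `G`. -/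
theorem isSmooth_of_pullback {η : DiffForm 𝓘(ℝ, G) (CosetSpace Λ) n}
    {ζ : G → G [⋀^Fin n]→L[ℝ] ℝ} (hζ : ContDiff ℝ ∞ ζ)
    (h : η.pullback 𝓘(ℝ, G) 𝓘(ℝ, G) (proj Λ) = ζ) : η.IsSmooth := by
  intro x
  rw [inChart_eq, h]
  exact hζ.contDiffAt.contDiffWithinAt

theorem pullback_proj_apply (η : DiffForm 𝓘(ℝ, G) (CosetSpace Λ) n) (g : G) (v : Fin n → G) :
    (η.pullback 𝓘(ℝ, G) 𝓘(ℝ, G) (proj Λ) g : G [⋀^Fin n]→L[ℝ] ℝ) v =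
      (η (proj Λ g) : G [⋀^Fin n]→L[ℝ] ℝ) (fun i => projDeriv (Λ := Λ) g (v i)) := by
  simp only [projDeriv_apply]
  rfl

/-- A form on `Λ \ G` is determined by its pullback to `G`. -/
theorem eq_of_pullback_eq {η ξ : DiffForm 𝓘(ℝ, G) (CosetSpace Λ) n}
    (h : η.pullback 𝓘(ℝ, G) 𝓘(ℝ, G) (proj Λ) = ξ.pullback 𝓘(ℝ, G) 𝓘(ℝ, G) (proj Λ)) : η = ξ := by
  funext x
  obtain ⟨g, rfl⟩ := proj_surjective x
  refine ContinuousAlternatingMap.ext fun (v : Fin n → G) => ?_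
  have h1 := DFunLike.congr_fun (congrFun h g) (fun i => (projDeriv (Λ := Λ) g).symm (v i))
  have h2 := ((pullback_proj_apply η g _).symm.trans h1).trans (pullback_proj_apply ξ g _)
  simpa only [ContinuousLinearEquiv.apply_symm_apply] using h2

/-- The exterior derivative on `Λ \ G` can be computed on `G`. -/
theorem d_eq_of_pullback {η : DiffForm 𝓘(ℝ, G) (CosetSpace Λ) n}
    {ξ : DiffForm 𝓘(ℝ, G) (CosetSpace Λ) (n + 1)} {ζ : G → G [⋀^Fin n]→L[ℝ] ℝ}
    (h : η.pullback 𝓘(ℝ, G) 𝓘(ℝ, G) (proj Λ) = ζ)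
    (hd : ξ.pullback 𝓘(ℝ, G) 𝓘(ℝ, G) (proj Λ) = extDeriv ζ) : η.d = ξ := by
  funext x
  have h1 : η.d x = (ξ.pullback 𝓘(ℝ, G) 𝓘(ℝ, G) (proj Λ)).pullback 𝓘(ℝ, G) 𝓘(ℝ, G)
      (chartAt G x) x := by
    unfold DiffForm.d
    rw [inChart_eq, h, hd, modelWithCornersSelf_coe, Set.range_id, extDerivWithin_univ]
    rfl
  rw [h1, DiffForm.pullback_pullback_at _ (mdifferentiable_proj Λ _)
    ((contMDiffAt_chartAt x).mdifferentiableAt (by simp)),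
    DiffForm.pullback_congr_at (f' := id), DiffForm.pullback_id]
  filter_upwards [(chartAt G x).open_source.mem_nhds (mem_chart_source G x)] with y hy
  exact proj_chartAt hy

/-- A left invariant form is the pullback of the form which it induces on `Λ \ G`. -/
theorem pullback_proj_induced {η : DiffForm 𝓘(ℝ, G) G n} (hη : η.IsLeftInvariant) :
    (DiffForm.induced Λ η).pullback 𝓘(ℝ, G) 𝓘(ℝ, G) (proj Λ) = η := by
  funext g
  obtain ⟨l, hl, hlg⟩ := proj_eq_proj.1 (Quotient.out_eq (proj Λ g) :
    proj Λ (proj Λ g).out = proj Λ g).symm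
  have hcomp : ∀ v : G, projDeriv (Λ := Λ) g v = projDeriv (Λ := Λ) (l * g)
      ((mfderiv 𝓘(ℝ, G) 𝓘(ℝ, G) (fun h => l * h) g : G →L[ℝ] G) v) := by
    intro v
    have h1 := mfderiv_comp (I := 𝓘(ℝ, G)) (I' := 𝓘(ℝ, G)) (I'' := 𝓘(ℝ, G)) g
      (mdifferentiable_proj Λ (l * g))
      ((contMDiff_mul_left (I := 𝓘(ℝ, G)) (n := ∞) (a := l)).mdifferentiable (by simp) g)
    have h3 : proj Λ ∘ (fun h => l * h) = proj Λ := funext fun y => proj_mul hl y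
    rw [h3] at h1
    exact ((projDeriv_apply g v).trans (congrArg (fun A : G →L[ℝ] G => A v) h1)).trans
      (projDeriv_apply (l * g) _).symm
  refine ContinuousAlternatingMap.ext fun (v : Fin n → G) => ?_
  rw [pullback_proj_apply, ← congrFun (hη l) g]
  change (η (proj Λ g).out : G [⋀^Fin n]→L[ℝ] ℝ) (fun i =>
      (mfderiv 𝓘(ℝ, G) 𝓘(ℝ, G) (proj Λ) (proj Λ g).out : G →L[ℝ] G).inverse
        (projDeriv (Λ := Λ) g (v i))) =
    (η (l * g) : G [⋀^Fin n]→L[ℝ] ℝ) (fun i =>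
      (mfderiv 𝓘(ℝ, G) 𝓘(ℝ, G) (fun h => l * h) g : G →L[ℝ] G) (v i))
  rw [← hlg]
  congr 1
  funext i
  rw [hcomp, ← coe_projDeriv]
  erw [ContinuousLinearMap.inverse_equiv]
  exact (projDeriv (Λ := Λ) (l * g)).symm_apply_apply _

end Lie

end CosetSpace

/-! ### Lifting homeomorphisms to the covering groups -/

namespace CosetSpace

/-- Homeomorphic quotients of simply connected groups by covering actions of subgroups come from
isomorphic subgroups: a homeomorphism lifts to the groups, and the lift intertwines the deck
transformations. -/
theorem nonempty_mulEquiv_of_homeomorph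
    {G : Type*} [Group G] [TopologicalSpace G] [IsTopologicalGroup G] [SimplyConnectedSpace G]
    [LocallyPathConnectedSpace G]
    {G' : Type*} [Group G'] [TopologicalSpace G'] [IsTopologicalGroup G'] [SimplyConnectedSpace G']
    [LocallyPathConnectedSpace G']
    {Λ : Subgroup G} {Λ' : Subgroup G'} (hΛ : IsCoveringMap (proj Λ))
    (hΛ' : IsCoveringMap (proj Λ')) (φ : CosetSpace Λ ≃ₜ CosetSpace Λ') :
    Nonempty (Λ ≃* Λ') := by
  obtain ⟨a, ha⟩ := proj_surjective (φ (proj Λ 1))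
  obtain ⟨F, ⟨hF1, hF⟩, -⟩ := hΛ'.existsUnique_continuousMap_lifts
    ⟨fun g => φ (proj Λ g), φ.continuous.comp hΛ.continuous⟩ 1 a ha
  obtain ⟨F', ⟨hF'1, hF'⟩, -⟩ := hΛ.existsUnique_continuousMap_lifts
    ⟨fun g => φ.symm (proj Λ' g), φ.symm.continuous.comp hΛ'.continuous⟩ a 1
    (by simp [ha])
  have hF : ∀ g, proj Λ' (F g) = φ (proj Λ g) := fun g => congrFun hF g
  have hF' : ∀ g, proj Λ (F' g) = φ.symm (proj Λ' g) := fun g => congrFun hF' g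
  have hFF' : ∀ g, F (F' g) = g := congrFun (hΛ'.eq_of_comp_eq (F.comp F').continuous
    continuous_id (funext fun g => by simp [hF, hF']) a (by simp [hF1, hF'1]))
  have hF'F : ∀ g, F' (F g) = g := congrFun (hΛ.eq_of_comp_eq (F'.comp F).continuous
    continuous_id (funext fun g => by simp [hF, hF']) 1 (by simp [hF1, hF'1]))
  -- `F (l * ·)` and `F` lift the same map, so they differ by a deck transformation `l'`.
  have hex : ∀ l : Λ, ∃ l' : Λ', ∀ g, F (l * g) = l' * F g := by
    intro l
    obtain ⟨l', hl', e⟩ := proj_eq_proj.1 (show proj Λ' (F 1) = proj Λ' (F (l * 1)) by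
      rw [hF, hF, proj_mul l.2])
    refine ⟨⟨l', hl'⟩, congrFun (hΛ'.eq_of_comp_eq
      (F.continuous.comp (continuous_const.mul continuous_id))
      (continuous_const.mul F.continuous) (funext fun g => ?_) 1 e.symm)⟩
    change proj Λ' (F (l * g)) = proj Λ' (l' * F g)
    rw [proj_mul hl', hF, hF, proj_mul l.2]
  choose θ hθ using hex
  have hmul : ∀ l m, θ (l * m) = θ l * θ m := by
    intro l m
    have h := hθ (l * m) 1
    rw [Subgroup.coe_mul, mul_assoc, hθ, hθ, ← mul_assoc] at h
    exact (Subtype.ext (mul_right_cancel h)).symm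
  -- `θ` is bijective because `F` is: the lift `F` carries the fibre over `proj Λ 1` to that over its
  -- image.
  refine ⟨MulEquiv.ofBijective (MonoidHom.mk' θ hmul) ⟨fun l m h => ?_, fun l' => ?_⟩⟩
  · have h : θ l = θ m := h
    have h1 : F (l * 1) = F (m * 1) := by rw [hθ, hθ, h]
    have h2 := congrArg F' h1
    rw [hF'F, hF'F] at h2
    exact Subtype.ext (mul_right_cancel h2)
  · obtain ⟨l, hl, e⟩ := proj_eq_proj.1 (show proj Λ 1 = proj Λ (F' (l' * a)) by
      rw [hF', proj_mul l'.2, ha, φ.symm_apply_apply])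
    refine ⟨⟨l, hl⟩, Subtype.ext ?_⟩
    have h := hθ ⟨l, hl⟩ 1
    rw [e, hFF', hF1] at h
    exact (mul_right_cancel h).symm

end CosetSpace

/-! ### The lattices are pairwise non-isomorphic -/

namespace Heis

open scoped commutatorElement

theorem commutatorElement_eq (g h : Heis) : ⁅g, h⁆ = mk 0 0 (x g * y h - y g * x h) := by
  rw [commutatorElement_def]
  ext
  · simp [mul_def, inv_def]
  · simp [mul_def, inv_def]
  · simp [mul_def, inv_def]
    ring

theorem mk_zero_zero_pow (c : ℝ) (n : ℕ) : mk 0 0 c ^ n = mk 0 0 (n * c) := by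
  induction n with
  | zero => simp [one_def]
  | succ n ih =>
    rw [pow_succ, ih]
    ext <;> simp [mul_def]
    ring

/-- The commutator subgroup of `Λ_k` is contained in `{(0, 0, c) | c ∈ ℤ}`. -/
theorem exists_int_of_mem_commutator {k : ℕ+} {g : lattice k} (hg : g ∈ commutator (lattice k)) :
    ∃ c : ℤ, (g : Heis) = mk 0 0 c := by
  rw [commutator_eq_closure] at hg
  induction hg using Subgroup.closure_induction with
  | mem g hg =>
    obtain ⟨a, b, rfl⟩ := hg
    obtain ⟨⟨a1, ha1⟩, ⟨a2, ha2⟩, -⟩ := a.2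
    obtain ⟨⟨b1, hb1⟩, ⟨b2, hb2⟩, -⟩ := b.2
    refine ⟨a1 * b2 - a2 * b1, ?_⟩
    have h : ((⁅a, b⁆ : lattice k) : Heis) = ⁅(a : Heis), (b : Heis)⁆ := rfl
    rw [h, commutatorElement_eq, ha1, ha2, hb1, hb2]
    push_cast
    rfl
  | one => exact ⟨0, by simp [one_def]⟩
  | mul a b _ _ ha hb =>
    obtain ⟨c, hc⟩ := ha
    obtain ⟨d, hd⟩ := hb
    exact ⟨c + d, by rw [Subgroup.coe_mul, hc, hd]; ext <;> simp [mul_def]⟩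
  | inv a _ ha =>
    obtain ⟨c, hc⟩ := ha
    exact ⟨-c, by rw [Subgroup.coe_inv, hc]; ext <;> simp [inv_def]⟩

theorem mk_mem_lattice (k : ℕ+) (a b c : ℤ) : mk a b (c / (2 * (k : ℕ))) ∈ lattice k :=
  ⟨⟨a, rfl⟩, ⟨b, rfl⟩, ⟨c, rfl⟩⟩

/-- The element `(a, b, c / 2k)` of `Λ_k`. -/
def latticeMk (k : ℕ+) (a b c : ℤ) : lattice k := ⟨_, mk_mem_lattice k a b c⟩

theorem coe_latticeMk (k : ℕ+) (a b c : ℤ) :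
    (latticeMk k a b c : Heis) = mk a b (c / (2 * (k : ℕ))) := rfl

theorem mem_center_iff {k : ℕ+} {g : lattice k} :
    g ∈ Subgroup.center (lattice k) ↔ ∃ c : ℤ, g = latticeMk k 0 0 c := by
  constructor
  · intro hg
    rw [Subgroup.mem_center_iff] at hg
    have key : ∀ a b : ℤ, (a : ℝ) * y (g : Heis) - b * x (g : Heis) = 0 := by
      intro a b
      have h : ⁅(latticeMk k a b 0 : Heis), (g : Heis)⁆ = 1 := by
        rw [commutatorElement_eq_one_iff_mul_comm]
        exact congrArg Subtype.val (hg (latticeMk k a b 0))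
      rw [commutatorElement_eq, coe_latticeMk] at h
      exact congrArg z h
    have hy : y (g : Heis) = 0 := by simpa using key 1 0
    have hx : x (g : Heis) = 0 := by simpa using key 0 1
    obtain ⟨-, -, c, hc⟩ := g.2
    refine ⟨c, Subtype.ext ?_⟩
    rw [coe_latticeMk]
    ext
    · simpa using hx
    · simpa using hy
    · exact hc
  · rintro ⟨c, rfl⟩
    rw [Subgroup.mem_center_iff]
    intro h
    refine Subtype.ext ?_
    rw [Subgroup.coe_mul, Subgroup.coe_mul, coe_latticeMk]
    ext <;> simp [mul_def, add_comm]

/-- In `Λ_k`, the quotient of the center by the commutator subgroup is cyclic of order `2k`. -/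
theorem forall_center_pow_mem_commutator_iff (k : ℕ+) (n : ℕ) :
    (∀ g ∈ Subgroup.center (lattice k), g ^ n ∈ commutator (lattice k)) ↔ 2 * (k : ℕ) ∣ n := by
  have hk : ((k : ℕ) : ℝ) ≠ 0 := by exact_mod_cast k.ne_zero
  constructor
  · intro h
    obtain ⟨c, hc⟩ := exists_int_of_mem_commutator (h _ (mem_center_iff.2 ⟨1, rfl⟩))
    rw [Subgroup.coe_pow, coe_latticeMk] at hc
    simp only [Int.cast_zero, mk_zero_zero_pow] at hc
    have hc : (n : ℝ) * (((1 : ℤ) : ℝ) / (2 * (k : ℕ))) = c := congrArg z hc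
    have h2 : (n : ℤ) = ((2 * (k : ℕ) : ℕ) : ℤ) * c := by
      have : (n : ℝ) = 2 * (k : ℕ) * c := by
        rw [← hc]
        push_cast
        field_simp
      exact_mod_cast this
    exact Int.natCast_dvd_natCast.1 ⟨c, h2⟩
  · rintro ⟨m, rfl⟩ g hg
    obtain ⟨c, rfl⟩ := mem_center_iff.1 hg
    -- `(0, 0, c / 2k) ^ (2km) = (0, 0, cm)` is the commutator of `(cm, 0, 0)` and `(0, 1, 0)`.
    have h : latticeMk k 0 0 c ^ (2 * (k : ℕ) * m) =
        ⁅latticeMk k (c * m) 0 0, latticeMk k 0 1 0⁆ := by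
      refine Subtype.ext ?_
      have h1 : ((⁅latticeMk k (c * m) 0 0, latticeMk k 0 1 0⁆ : lattice k) : Heis) =
        ⁅(latticeMk k (c * m) 0 0 : Heis), (latticeMk k 0 1 0 : Heis)⁆ := rfl
      rw [h1, commutatorElement_eq, Subgroup.coe_pow, coe_latticeMk, coe_latticeMk, coe_latticeMk]
      simp only [Int.cast_zero, mk_zero_zero_pow]
      ext
      · simp
      · simp
      · simp
        field_simp
    rw [h]
    exact Subgroup.commutator_mem_commutator (Subgroup.mem_top _) (Subgroup.mem_top _)

/-- An isomorphism `Λ_i ≃ Λ_j` preserves the order `2i` of the quotient of the center by the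
commutator subgroup. -/
theorem eq_of_mulEquiv {i j : ℕ+} (e : lattice i ≃* lattice j) : i = j := by
  have key : ∀ {i j : ℕ+} (_ : lattice i ≃* lattice j), 2 * (j : ℕ) ∣ 2 * (i : ℕ) := by
    intro i j e
    rw [← forall_center_pow_mem_commutator_iff]
    intro g hg
    have h1 : e.symm g ∈ Subgroup.center (lattice i) := by
      rw [Subgroup.mem_center_iff] at hg ⊢
      intro h
      apply e.injective
      simpa using hg (e h)
    have h2 := (forall_center_pow_mem_commutator_iff i _).2 dvd_rfl _ h1
    have h3 : (commutator (lattice i)).map e.toMonoidHom ≤ commutator (lattice j) := by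
      rw [commutator_def, Subgroup.map_commutator]
      exact Subgroup.commutator_mono le_top le_top
    simpa using h3 (Subgroup.mem_map_of_mem e.toMonoidHom h2)
  have h := Nat.dvd_antisymm (key e) (key e.symm)
  exact PNat.eq (by omega)

theorem isEmpty_diffeomorph {i j : ℕ+} (h : i ≠ j) :
    IsEmpty (Diffeomorph 𝓘(ℝ, Heis) 𝓘(ℝ, Heis) (HeisNil i) (HeisNil j) ∞) :=
  ⟨fun φ => h (eq_of_mulEquiv (CosetSpace.nonempty_mulEquiv_of_homeomorph
    (CosetSpace.isQuotientCoveringMap_proj _).isCoveringMap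
    (CosetSpace.isQuotientCoveringMap_proj _).isCoveringMap φ.toHomeomorph).some)⟩

end Heis

namespace DiffForm

/-- A differential form on a vector space, as a function to the space of alternating maps. -/
def toMap {E : Type*} [NormedAddCommGroup E] [NormedSpace ℝ E] {n : ℕ}
    (η : DiffForm 𝓘(ℝ, E) E n) : E → E [⋀^Fin n]→L[ℝ] ℝ := η

theorem pullback_apply_of_hasFDerivAt {E E' : Type*} [NormedAddCommGroup E] [NormedSpace ℝ E]
    [NormedAddCommGroup E'] [NormedSpace ℝ E'] {n : ℕ} (η : DiffForm 𝓘(ℝ, E') E' n) {f : E → E'}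
    {A : E →L[ℝ] E'} {x : E} (h : HasFDerivAt f A x) (v : Fin n → E) :
    (η.pullback 𝓘(ℝ, E) 𝓘(ℝ, E') f x : E [⋀^Fin n]→L[ℝ] ℝ) v =
      (η (f x) : E' [⋀^Fin n]→L[ℝ] ℝ) (fun i => A (v i)) := by
  rw [← h.fderiv, ← mfderiv_eq_fderiv]
  rfl

section LeftInvariant

variable {E : Type*} [NormedAddCommGroup E] [NormedSpace ℝ E]
  {H : Type*} [TopologicalSpace H] {I : ModelWithCorners ℝ E H}
  {G : Type*} [Group G] [TopologicalSpace G] [ChartedSpace H G] {n : ℕ}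

theorem pullback_smul {E' : Type*} [NormedAddCommGroup E'] [NormedSpace ℝ E']
    {H' : Type*} [TopologicalSpace H'] {J : ModelWithCorners ℝ E' H'}
    {M : Type*} [TopologicalSpace M] [ChartedSpace H' M] (f : M → G) (c : ℝ)
    (η : DiffForm I G n) : (c • η).pullback J I f = c • η.pullback J I f := rfl

theorem IsLeftInvariant.const_smul {η : DiffForm I G n} (h : η.IsLeftInvariant) (c : ℝ) :
    (c • η).IsLeftInvariant := fun g => by rw [pullback_smul, h g]

/-- A left invariant form is determined by its value at `1`. -/
theorem IsLeftInvariant.eq_of_apply_one_eq {η ξ : DiffForm I G n} (hη : η.IsLeftInvariant)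
    (hξ : ξ.IsLeftInvariant) (h : η 1 = ξ 1) : η = ξ := by
  funext g
  have key : ∀ u : G, u = 1 → (η u : E [⋀^Fin n]→L[ℝ] ℝ) = ξ u := by
    rintro u rfl
    exact h
  rw [← hη g⁻¹, ← hξ g⁻¹]
  exact congrArg (fun A : E [⋀^Fin n]→L[ℝ] ℝ =>
    A.compContinuousLinearMap (mfderiv I I (fun h => g⁻¹ * h) g)) (key _ (inv_mul_cancel g))

end LeftInvariant

end DiffForm

theorem wedgeCovectors_apply {V : Type*} [NormedAddCommGroup V] [NormedSpace ℝ V] {n : ℕ}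
    (θ : Fin n → (V →L[ℝ] ℝ)) (v : Fin n → V) :
    wedgeCovectors θ v = Matrix.det (Matrix.of fun i j => θ j (v i)) := rfl

/-! ### Left invariant forms on the Heisenberg group -/

namespace Heis

/-- The derivative of left translation by `g`, which does not depend on the point. -/
def leftDeriv (g : Heis) : Heis →L[ℝ] Heis :=
  x.prod (y.prod (z + (1 / 2 : ℝ) • (x g • y - y g • x)))

@[simp] theorem x_leftDeriv (g v : Heis) : x (leftDeriv g v) = x v := rfl
@[simp] theorem y_leftDeriv (g v : Heis) : y (leftDeriv g v) = y v := rfl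
@[simp] theorem z_leftDeriv (g v : Heis) :
    z (leftDeriv g v) = z v + (1 / 2 : ℝ) * (x g * y v - y g * x v) := rfl

theorem mul_eq_leftDeriv_add (g h : Heis) : g * h = leftDeriv g h + g := by
  ext
  · simp [mul_def, add_comm]
  · simp [mul_def, add_comm]
  · simp [mul_def]
    ring

theorem hasFDerivAt_mul_left (g h : Heis) : HasFDerivAt (fun h => g * h) (leftDeriv g) h := by
  simp_rw [mul_eq_leftDeriv_add]
  exact (leftDeriv g).hasFDerivAt.add_const g

@[simp] theorem coframe_zero (g v : Heis) : coframe g 0 v = x v := rfl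
@[simp] theorem coframe_one (g v : Heis) : coframe g 1 v = y v := rfl
@[simp] theorem coframe_two (g v : Heis) :
    coframe g 2 v = z v + (1 / 2 : ℝ) * (y g * x v - x g * y v) := rfl

theorem coframe_mul_leftDeriv (g h v : Heis) (i : Fin 3) :
    coframe (g * h) i (leftDeriv g v) = coframe h i v := by
  fin_cases i
  · rfl
  · rfl
  · simp [mul_def]
    ring

theorem vol_apply (g : Heis) (v : Fin 3 → Heis) :
    (vol g : Heis [⋀^Fin 3]→L[ℝ] ℝ) v = Matrix.det (Matrix.of fun i j => coframe g j (v i)) := rfl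

theorem isLeftInvariant_vol : vol.IsLeftInvariant := by
  intro g
  funext h
  refine ContinuousAlternatingMap.ext fun (v : Fin 3 → Heis) => ?_
  refine (DiffForm.pullback_apply_of_hasFDerivAt vol (hasFDerivAt_mul_left g h) v).trans ?_
  rw [vol_apply, vol_apply]
  simp_rw [coframe_mul_leftDeriv]

/-- The form `ω₁ ∧ ω₂ ∧ ω₃ = dx ∧ dy ∧ dz` has constant coefficients. -/
theorem vol_eq_vol_one (g : Heis) : (vol g : Heis [⋀^Fin 3]→L[ℝ] ℝ) = vol 1 := by
  refine ContinuousAlternatingMap.ext fun (v : Fin 3 → Heis) => ?_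
  refine (vol_apply g v).trans (Eq.trans ?_ (vol_apply 1 v).symm)
  simp [Matrix.det_fin_three, one_def]
  ring

/-- The standard basis of `H₃ = ℝ³`. -/
def basis : Module.Basis (Fin 3) ℝ Heis :=
  Module.Basis.ofEquivFun
    { toFun := fun g => ![x g, y g, z g]
      map_add' := fun g h => by ext i; fin_cases i <;> simp
      map_smul' := fun c g => by ext i; fin_cases i <;> simp
      invFun := fun v => mk (v 0) (v 1) (v 2)
      left_inv := fun g => rfl
      right_inv := fun v => by ext i; fin_cases i <;> rfl }

theorem vol_basis : (vol 1 : Heis [⋀^Fin 3]→L[ℝ] ℝ) basis = 1 := by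
  have h0 : basis 0 = mk 1 0 0 := by
    apply basis.equivFun.injective
    ext i
    rw [basis.equivFun_self]
    fin_cases i <;> simp [basis] <;> rfl
  have h1 : basis 1 = mk 0 1 0 := by
    apply basis.equivFun.injective
    ext i
    rw [basis.equivFun_self]
    fin_cases i <;> simp [basis] <;> rfl
  have h2 : basis 2 = mk 0 0 1 := by
    apply basis.equivFun.injective
    ext i
    rw [basis.equivFun_self]
    fin_cases i <;> simp [basis] <;> rfl
  rw [vol_apply, Matrix.det_fin_three]
  simp [h0, h1, h2, one_def]

/-- Left invariant 3-forms are determined by their value at `1`, and the 3-forms on `ℝ³` are the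
multiples of the determinant. -/
theorem exists_eq_smul_vol {H : DiffForm 𝓘(ℝ, Heis) Heis 3} (hH : H.IsLeftInvariant) :
    ∃ c : ℝ, H = c • vol := by
  refine ⟨(H 1 : Heis [⋀^Fin 3]→L[ℝ] ℝ) basis,
    hH.eq_of_apply_one_eq (isLeftInvariant_vol.const_smul _) ?_⟩
  have h1 := (H 1 : Heis [⋀^Fin 3]→L[ℝ] ℝ).toAlternatingMap.eq_smul_basis_det basis
  have h2 := (vol 1 : Heis [⋀^Fin 3]→L[ℝ] ℝ).toAlternatingMap.eq_smul_basis_det basis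
  have h3 : (vol 1 : Heis [⋀^Fin 3]→L[ℝ] ℝ).toAlternatingMap = basis.det := by
    rw [h2]
    exact (congrArg (fun r : ℝ => r • basis.det) vol_basis).trans (one_smul ℝ _)
  refine ContinuousAlternatingMap.ext fun (v : Fin 3 → Heis) => ?_
  have h4 := DFunLike.congr_fun h1 v
  rw [← h3] at h4
  exact h4

theorem toMap_smul_vol (c : ℝ) : (c • vol).toMap = fun _ => (c • vol).toMap 1 :=
  funext fun g => congrArg (fun A : Heis [⋀^Fin 3]→L[ℝ] ℝ => c • A) (vol_eq_vol_one g)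

theorem contDiff_smul_vol (c : ℝ) :
    ContDiff ℝ ∞ (c • vol).toMap := by
  rw [toMap_smul_vol]
  exact contDiff_const

theorem extDeriv_smul_vol (c : ℝ) :
    extDeriv (c • vol).toMap = 0 := by
  rw [toMap_smul_vol]
  funext g
  rw [extDeriv, fderiv_fun_const]
  exact (ContinuousAlternatingMap.alternatizeUncurryFinCLM ℝ Heis ℝ).map_zero

end Heis

/-! ### The form `Ω₃ ∧ Ω̃₃` on the group `C` -/

namespace CorrGroup

@[simp] theorem fst_mul (g h : CorrGroup) : fst (g * h) = fst g * fst h := rfl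

@[simp] theorem x_snd (g : CorrGroup) : Heis.x (snd g) = Heis.x (fst g) := rfl
@[simp] theorem y_snd (g : CorrGroup) : Heis.y (snd g) = Heis.y (fst g) := rfl

@[simp] theorem snd_mul (g h : CorrGroup) : snd (g * h) = snd g * snd h := rfl

/-- The derivative of left translation by `g`, which does not depend on the point. -/
def leftDeriv (g : CorrGroup) : CorrGroup →L[ℝ] CorrGroup :=
  (Heis.x.comp fst).prod ((Heis.y.comp fst).prod
    ((Heis.z.comp ((Heis.leftDeriv (fst g)).comp fst)).prod
      (Heis.z.comp ((Heis.leftDeriv (snd g)).comp snd))))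

@[simp] theorem fst_leftDeriv (g v : CorrGroup) :
    fst (leftDeriv g v) = Heis.leftDeriv (fst g) (fst v) := rfl

@[simp] theorem snd_leftDeriv (g v : CorrGroup) :
    snd (leftDeriv g v) = Heis.leftDeriv (snd g) (snd v) := rfl

theorem mul_eq_leftDeriv_add (g h : CorrGroup) : g * h = leftDeriv g h + g := by
  apply ext
  · rw [fst_mul, Heis.mul_eq_leftDeriv_add, map_add, fst_leftDeriv]
  · rw [snd_mul, Heis.mul_eq_leftDeriv_add, map_add, snd_leftDeriv]

theorem hasFDerivAt_mul_left (g h : CorrGroup) : HasFDerivAt (fun h => g * h) (leftDeriv g) h := by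
  simp_rw [mul_eq_leftDeriv_add]
  exact (leftDeriv g).hasFDerivAt.add_const g

theorem fibreForm_apply (g : CorrGroup) (v : Fin 2 → CorrGroup) :
    (fibreForm g : CorrGroup [⋀^Fin 2]→L[ℝ] ℝ) v =
      Heis.coframe (fst g) 2 (fst (v 0)) * Heis.coframe (snd g) 2 (snd (v 1)) -
      Heis.coframe (snd g) 2 (snd (v 0)) * Heis.coframe (fst g) 2 (fst (v 1)) := by
  refine Eq.trans (wedgeCovectors_apply _ v) ?_
  rw [Matrix.det_fin_two]
  rfl

theorem isLeftInvariant_fibreForm : fibreForm.IsLeftInvariant := by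
  intro g
  funext h
  refine ContinuousAlternatingMap.ext fun (v : Fin 2 → CorrGroup) => ?_
  refine (DiffForm.pullback_apply_of_hasFDerivAt fibreForm (hasFDerivAt_mul_left g h) v).trans ?_
  rw [fibreForm_apply, fibreForm_apply]
  simp_rw [fst_leftDeriv, snd_leftDeriv, fst_mul, snd_mul, Heis.coframe_mul_leftDeriv]

/-- The coordinate form `dz ∧ dz'` on `C`. -/
def dzdz : CorrGroup [⋀^Fin 2]→L[ℝ] ℝ := wedgeCovectors ![Heis.z.comp fst, Heis.z.comp snd]

/-- The coordinate form `dx ∧ (dz' - dz)` on `C`. -/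
def dxdz : CorrGroup [⋀^Fin 2]→L[ℝ] ℝ :=
  wedgeCovectors ![Heis.x.comp fst, Heis.z.comp snd - Heis.z.comp fst]

/-- The coordinate form `dy ∧ (dz' - dz)` on `C`. -/
def dydz : CorrGroup [⋀^Fin 2]→L[ℝ] ℝ :=
  wedgeCovectors ![Heis.y.comp fst, Heis.z.comp snd - Heis.z.comp fst]

theorem dzdz_apply (v : Fin 2 → CorrGroup) : dzdz v =
    Heis.z (fst (v 0)) * Heis.z (snd (v 1)) - Heis.z (snd (v 0)) * Heis.z (fst (v 1)) := by
  refine Eq.trans (wedgeCovectors_apply _ v) ?_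
  rw [Matrix.det_fin_two]
  rfl

theorem dxdz_apply (v : Fin 2 → CorrGroup) : dxdz v =
    Heis.x (fst (v 0)) * (Heis.z (snd (v 1)) - Heis.z (fst (v 1))) -
      (Heis.z (snd (v 0)) - Heis.z (fst (v 0))) * Heis.x (fst (v 1)) := by
  refine Eq.trans (wedgeCovectors_apply _ v) ?_
  rw [Matrix.det_fin_two]
  rfl

theorem dydz_apply (v : Fin 2 → CorrGroup) : dydz v =
    Heis.y (fst (v 0)) * (Heis.z (snd (v 1)) - Heis.z (fst (v 1))) -
      (Heis.z (snd (v 0)) - Heis.z (fst (v 0))) * Heis.y (fst (v 1)) := by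
  refine Eq.trans (wedgeCovectors_apply _ v) ?_
  rw [Matrix.det_fin_two]
  rfl

/-- The coefficients of `Ω₃ ∧ Ω̃₃` in the coordinates are affine functions. -/
theorem fibreForm_eq (c : ℝ) : (c • fibreForm).toMap =
    fun g => c • dzdz + ((Heis.y.comp fst).smulRight ((c / 2) • dxdz) -
      (Heis.x.comp fst).smulRight ((c / 2) • dydz)) g := by
  funext g
  refine ContinuousAlternatingMap.ext fun (v : Fin 2 → CorrGroup) => ?_
  change c * (fibreForm g : CorrGroup [⋀^Fin 2]→L[ℝ] ℝ) v = c * dzdz v +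
    (Heis.y (fst g) * (c / 2 * dxdz v) - Heis.x (fst g) * (c / 2 * dydz v))
  rw [fibreForm_apply, dzdz_apply, dxdz_apply, dydz_apply]
  simp only [Heis.coframe_two, x_snd, y_snd]
  ring

theorem contDiff_smul_fibreForm (c : ℝ) :
    ContDiff ℝ ∞ (c • fibreForm).toMap := by
  rw [fibreForm_eq]
  exact contDiff_const.add (ContinuousLinearMap.contDiff _)

/-- The identity `d(Ω₃ ∧ Ω̃₃) = p^*(ω₁ ∧ ω₂ ∧ ω₃) - p^∨^*(ω₁ ∧ ω₂ ∧ ω₃)` on `C`. -/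
theorem extDeriv_smul_fibreForm (c : ℝ) :
    extDeriv (c • fibreForm).toMap =
      (c • Heis.vol).pullback 𝓘(ℝ, CorrGroup) 𝓘(ℝ, Heis) fst -
      (c • Heis.vol).pullback 𝓘(ℝ, CorrGroup) 𝓘(ℝ, Heis) snd := by
  funext g
  refine ContinuousAlternatingMap.ext fun (v : Fin 3 → CorrGroup) => ?_
  have h1 := DiffForm.pullback_apply_of_hasFDerivAt (c • Heis.vol)
    (fst.hasFDerivAt (x := g)) v
  have h2 := DiffForm.pullback_apply_of_hasFDerivAt (c • Heis.vol)
    (snd.hasFDerivAt (x := g)) v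
  refine Eq.trans ?_ (congrArg₂ (· - ·) h1.symm h2.symm)
  rw [extDeriv, fibreForm_eq, fderiv_const_add, ContinuousLinearMap.fderiv,
    ContinuousAlternatingMap.alternatizeUncurryFin_apply]
  change ∑ i : Fin 3, (-1) ^ i.val • (Heis.y (fst (v i)) * (c / 2 * dxdz (i.removeNth v)) -
      Heis.x (fst (v i)) * (c / 2 * dydz (i.removeNth v))) =
    c * (Heis.vol (fst g) : Heis [⋀^Fin 3]→L[ℝ] ℝ) (fun i => fst (v i)) -
    c * (Heis.vol (snd g) : Heis [⋀^Fin 3]→L[ℝ] ℝ) (fun i => snd (v i))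
  rw [Heis.vol_apply, Heis.vol_apply, Matrix.det_fin_three, Matrix.det_fin_three,
    Fin.sum_univ_three]
  have e1 : ∀ w : Fin 3 → CorrGroup, (0 : Fin 3).removeNth w = ![w 1, w 2] := fun w => by
    funext i; fin_cases i <;> rfl
  have e2 : ∀ w : Fin 3 → CorrGroup, (1 : Fin 3).removeNth w = ![w 0, w 2] := fun w => by
    funext i; fin_cases i <;> rfl
  have e3 : ∀ w : Fin 3 → CorrGroup, (2 : Fin 3).removeNth w = ![w 0, w 1] := fun w => by
    funext i; fin_cases i <;> rfl
  simp only [e1, e2, e3, dxdz_apply, dydz_apply, Matrix.of_apply, Heis.coframe_zero,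
    Heis.coframe_one, Heis.coframe_two, x_snd, y_snd, Matrix.cons_val_zero, Matrix.cons_val_one,
    Fin.val_zero, Fin.val_one, Fin.val_two, pow_zero, pow_one, one_smul, neg_smul, zsmul_eq_mul]
  norm_num
  ring

end CorrGroup

namespace CosetSpace

variable {G : Type*} [NormedAddCommGroup G] [NormedSpace ℝ G] [LocallyCompactSpace G]
  [Group G] [IsTopologicalGroup G] [LieGroup 𝓘(ℝ, G) ∞ G]
  {Λ : Subgroup G} [DiscreteTopology Λ]
  {E' : Type*} [NormedAddCommGroup E'] [NormedSpace ℝ E']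
  {H' : Type*} [TopologicalSpace H'] {J : ModelWithCorners ℝ E' H'}
  {N : Type*} [TopologicalSpace N] [ChartedSpace H' N]

/-- A map on `Λ \ G` is smooth where its composition with `G → Λ \ G` is. -/
theorem contMDiffAt_of_comp_proj {f : CosetSpace Λ → N} {x : CosetSpace Λ}
    (h : ∀ g, proj Λ g = x → ContMDiffAt 𝓘(ℝ, G) J ∞ (f ∘ proj Λ) g) :
    ContMDiffAt 𝓘(ℝ, G) J ∞ f x := by
  have h1 := (h _ (proj_chartAt (mem_chart_source G x))).comp x (contMDiffAt_chartAt x)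
  refine h1.congr_of_eventuallyEq ?_
  filter_upwards [(chartAt G x).open_source.mem_nhds (mem_chart_source G x)] with y hy
  exact (congrArg f (proj_chartAt hy)).symm

theorem contMDiff_of_comp_proj {f : CosetSpace Λ → N}
    (h : ContMDiff 𝓘(ℝ, G) J ∞ (f ∘ proj Λ)) : ContMDiff 𝓘(ℝ, G) J ∞ f :=
  fun _ => contMDiffAt_of_comp_proj fun g _ => h g

end CosetSpace

/-! ### Local logarithms on the circle -/

namespace Circle

theorem contMDiff_coe : ContMDiff (𝓡 1) 𝓘(ℝ, ℂ) ∞ (fun t : Circle => (t : ℂ)) :=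
  haveI : Fact (Module.finrank ℝ ℂ = 1 + 1) := finrank_real_complex_fact'
  contMDiff_coe_sphere (E := ℂ) (n := 1)

/-- The logarithm `(2 π i)⁻¹ log` on the circle which is smooth around `t₀`. -/
def logAt (t₀ t : Circle) : ℝ :=
  (Complex.arg ((t * t₀⁻¹ : Circle) : ℂ) + Complex.arg (t₀ : ℂ)) / (2 * Real.pi)

theorem exp_logAt (t₀ t : Circle) : Circle.exp (2 * Real.pi * logAt t₀ t) = t := by
  have h : 2 * Real.pi * logAt t₀ t =
      Complex.arg ((t * t₀⁻¹ : Circle) : ℂ) + Complex.arg (t₀ : ℂ) := by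
    unfold logAt
    field_simp
  rw [h, Circle.exp_add, Circle.exp_arg, Circle.exp_arg, inv_mul_cancel_right]

/-- The set on which `logAt t₀` is smooth. -/
def logDomain (t₀ : Circle) : Set Circle := {t | ((t * t₀⁻¹ : Circle) : ℂ) ∈ Complex.slitPlane}

theorem isOpen_logDomain (t₀ : Circle) : IsOpen (logDomain t₀) :=
  Complex.isOpen_slitPlane.preimage (continuous_subtype_val.comp (continuous_id.mul continuous_const))

theorem mem_logDomain_self (t₀ : Circle) : t₀ ∈ logDomain t₀ := by
  simp [logDomain]

theorem contMDiffAt_logAt {t₀ t : Circle} (ht : t ∈ logDomain t₀) :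
    ContMDiffAt (𝓡 1) 𝓘(ℝ, ℝ) ∞ (logAt t₀) t := by
  have h1 : ContMDiff (𝓡 1) 𝓘(ℝ, ℂ) ∞ (fun t : Circle => ((t * t₀⁻¹ : Circle) : ℂ)) :=
    Circle.contMDiff_coe.comp (contMDiff_mul_right (I := 𝓡 1) (a := t₀⁻¹))
  have h2 : ContDiffAt ℝ ∞ (fun z : ℂ => (Complex.arg z + Complex.arg (t₀ : ℂ)) / (2 * Real.pi))
      ((t * t₀⁻¹ : Circle) : ℂ) := by
    have h3 : ContDiffAt ℝ ∞ Complex.log ((t * t₀⁻¹ : Circle) : ℂ) :=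
      (Complex.contDiffAt_log ht).restrict_scalars ℝ
    have h4 : ContDiffAt ℝ ∞ (fun z : ℂ => Complex.arg z) ((t * t₀⁻¹ : Circle) : ℂ) := by
      simp_rw [← Complex.log_im]
      exact Complex.imCLM.contDiff.contDiffAt.comp _ h3
    exact (h4.add contDiffAt_const).div_const _
  exact h2.contMDiffAt.comp t (h1 t)

theorem exp_two_pi_mul_eq_iff {r s : ℝ} :
    Circle.exp (2 * Real.pi * r) = Circle.exp (2 * Real.pi * s) ↔ ∃ m : ℤ, r = s + m := by
  rw [Circle.exp_eq_exp]
  refine exists_congr fun m => ?_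
  constructor
  · intro h
    have : 2 * Real.pi * r = 2 * Real.pi * (s + m) := by rw [h]; ring
    exact mul_left_cancel₀ (by positivity) this
  · rintro rfl
    ring

end Circle

/-! ### The circle bundles `E_k → T²` -/

namespace Heis

open CosetSpace

variable {V : Type*} [NormedAddCommGroup V] [NormedSpace ℝ V]
  {HV : Type*} [TopologicalSpace HV] {I : ModelWithCorners ℝ V HV}
  {M : Type*} [TopologicalSpace M] [ChartedSpace HV M]

theorem contMDiffAt_mk {a b c : M → ℝ} {m : M} (ha : ContMDiffAt I 𝓘(ℝ, ℝ) ∞ a m)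
    (hb : ContMDiffAt I 𝓘(ℝ, ℝ) ∞ b m) (hc : ContMDiffAt I 𝓘(ℝ, ℝ) ∞ c m) :
    ContMDiffAt I 𝓘(ℝ, Heis) ∞ (fun v => mk (a v) (b v) (c v)) m := by
  have h : ContDiff ℝ ∞ (fun p : ℝ × ℝ × ℝ => mk p.1 p.2.1 p.2.2) :=
    contDiff_mk contDiff_fst (contDiff_fst.comp contDiff_snd) (contDiff_snd.comp contDiff_snd)
  exact h.contMDiff.contMDiffAt.comp m (ha.prodMk_space (hb.prodMk_space hc))

theorem contMDiffAt_mul {a b : M → Heis} {m : M} (ha : ContMDiffAt I 𝓘(ℝ, Heis) ∞ a m)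
    (hb : ContMDiffAt I 𝓘(ℝ, Heis) ∞ b m) :
    ContMDiffAt I 𝓘(ℝ, Heis) ∞ (fun v => a v * b v) m :=
  contDiff_mul.contMDiff.contMDiffAt.comp m (ha.prodMk_space hb)

theorem contMDiff_x : ContMDiff 𝓘(ℝ, Heis) 𝓘(ℝ, ℝ) ∞ x := x.contDiff.contMDiff
theorem contMDiff_y : ContMDiff 𝓘(ℝ, Heis) 𝓘(ℝ, ℝ) ∞ y := y.contDiff.contMDiff

variable (k : ℕ+)

theorem toTorus_proj (g : Heis) : toTorus k (proj (lattice k) g) =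
    (Circle.exp (2 * Real.pi * x g), Circle.exp (2 * Real.pi * y g)) := rfl

theorem two_mul_pos : (0 : ℝ) < 2 * (k : ℕ) := by
  have : (0 : ℝ) < (k : ℕ) := by exact_mod_cast k.pos
  linarith

theorem contMDiff_circleExp_two_pi : ContMDiff 𝓘(ℝ, ℝ) (𝓡 1) ∞
    (fun r : ℝ => Circle.exp (2 * Real.pi * r)) :=
  contMDiff_circleExp.comp (contDiff_const.mul contDiff_id).contMDiff

theorem contMDiff_toTorus :
    ContMDiff 𝓘(ℝ, Heis) ((𝓡 1).prod (𝓡 1)) ∞ (toTorus k) := by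
  apply contMDiff_of_comp_proj
  exact (contMDiff_circleExp_two_pi.comp contMDiff_x).prodMk
    (contMDiff_circleExp_two_pi.comp contMDiff_y)

theorem mul_mk_zero_zero (g : Heis) (c : ℝ) : g * mk 0 0 c = mk (x g) (y g) (z g + c) := by
  ext <;> simp [mul_def]

/-- Points of `H₃` on a common fibre of `H₃ → ℝ²` have the same image in `E_k` if and only if they
differ by a multiple of `1 / 2k`. -/
theorem proj_mk_eq_proj_mk_iff {a b c c' : ℝ} :
    proj (lattice k) (mk a b c) = proj (lattice k) (mk a b c') ↔
      ∃ m : ℤ, c' = c + m / (2 * (k : ℕ)) := by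
  rw [proj_eq_proj]
  constructor
  · rintro ⟨l, ⟨-, -, m, hm⟩, h⟩
    have hx : x l + a = a := congrArg x h
    have hy : y l + b = b := congrArg y h
    have hz : z l + c + (x l * b - y l * a) / 2 = c' := congrArg z h
    have hx0 : x l = 0 := by linarith
    have hy0 : y l = 0 := by linarith
    refine ⟨m, ?_⟩
    rw [← hz, hx0, hy0, hm]
    ring
  · rintro ⟨m, rfl⟩
    refine ⟨mk 0 0 (m / (2 * (k : ℕ))), ⟨⟨0, by simp⟩, ⟨0, by simp⟩, m, rfl⟩, ?_⟩
    ext <;> simp [mul_def, add_comm]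

/-- The action of `t` is translation by `(0, 0, r / 2k)` for every logarithm `r` of `t`, which allows
smooth local choices of `r`. -/
theorem circleAct_proj_of_exp {t : Circle} {r : ℝ} (h : Circle.exp (2 * Real.pi * r) = t)
    (g : Heis) : circleAct k (proj (lattice k) g) t =
      proj (lattice k) (g * mk 0 0 (r / (2 * (k : ℕ)))) := by
  have h1 : Circle.exp (2 * Real.pi * (Complex.arg t / (2 * Real.pi))) = t := by
    rw [mul_div_cancel₀ _ (by positivity), Circle.exp_arg]
  obtain ⟨m, hm⟩ := Circle.exp_two_pi_mul_eq_iff.1 (h.trans h1.symm)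
  change proj (lattice k) (g * mk 0 0 (Complex.arg t / (2 * Real.pi) / (2 * (k : ℕ)))) = _
  rw [mul_mk_zero_zero, mul_mk_zero_zero, proj_mk_eq_proj_mk_iff]
  exact ⟨m, by rw [hm]; ring⟩

theorem circleAct_proj_logAt (g : Heis) (t₀ t : Circle) : circleAct k (proj (lattice k) g) t =
    proj (lattice k) (g * mk 0 0 (Circle.logAt t₀ t / (2 * (k : ℕ)))) :=
  circleAct_proj_of_exp k (Circle.exp_logAt t₀ t) g

theorem circleAct_one (e : HeisNil k) : circleAct k e 1 = e := by
  obtain ⟨g, rfl⟩ := proj_surjective e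
  rw [circleAct_proj_of_exp k (r := 0) (by simp), mul_mk_zero_zero]
  simp only [zero_div, add_zero]
  rfl

theorem circleAct_mul (e : HeisNil k) (s t : Circle) :
    circleAct k e (s * t) = circleAct k (circleAct k e s) t := by
  obtain ⟨g, rfl⟩ := proj_surjective e
  rw [circleAct_proj_logAt k g 1 s, circleAct_proj_logAt k _ 1 t, circleAct_proj_of_exp k
    (r := Circle.logAt 1 s + Circle.logAt 1 t)
    (by rw [mul_add, Circle.exp_add, Circle.exp_logAt, Circle.exp_logAt]), mul_assoc]
  simp only [mul_mk_zero_zero, x_mk, y_mk, z_mk, add_div]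

theorem toTorus_circleAct (e : HeisNil k) (t : Circle) :
    toTorus k (circleAct k e t) = toTorus k e := by
  obtain ⟨g, rfl⟩ := proj_surjective e
  rw [circleAct_proj_logAt k g 1 t, mul_mk_zero_zero]
  rfl

/-- The action of the circle on `E_k` is free. -/
theorem circleAct_injective (e : HeisNil k) : Function.Injective (circleAct k e) := by
  intro s t h
  obtain ⟨g, rfl⟩ := proj_surjective e
  rw [circleAct_proj_logAt k g 1 s, circleAct_proj_logAt k g 1 t, mul_mk_zero_zero,
    mul_mk_zero_zero, proj_mk_eq_proj_mk_iff] at h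
  obtain ⟨m, hm⟩ := h
  have hk := two_mul_pos k
  rw [← Circle.exp_logAt 1 s, ← Circle.exp_logAt 1 t, eq_comm, Circle.exp_two_pi_mul_eq_iff]
  refine ⟨m, ?_⟩
  rw [add_assoc, ← add_div] at hm
  exact (div_left_inj' hk.ne').1 (add_left_cancel hm)

theorem contMDiff_circleAct : ContMDiff (𝓘(ℝ, Heis).prod (𝓡 1)) 𝓘(ℝ, Heis) ∞
    (fun p : HeisNil k × Circle => circleAct k p.1 p.2) := by
  rintro ⟨e, t⟩
  have h1 : ContMDiffAt (𝓘(ℝ, Heis).prod (𝓡 1)) 𝓘(ℝ, Heis) ∞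
      (fun p : HeisNil k × Circle =>
        chartAt Heis e p.1 * mk 0 0 (Circle.logAt t p.2 / (2 * (k : ℕ)))) (e, t) := by
    have h2 : ContMDiffAt (𝓘(ℝ, Heis).prod (𝓡 1)) 𝓘(ℝ, ℝ) ∞
        (fun p : HeisNil k × Circle => Circle.logAt t p.2 / (2 * (k : ℕ))) (e, t) :=
      (contDiff_id.div_const _ : ContDiff ℝ ∞ fun r : ℝ => r / (2 * (k : ℕ))).contMDiff.contMDiffAt.comp
        (e, t) ((Circle.contMDiffAt_logAt (Circle.mem_logDomain_self t)).comp (e, t)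
          contMDiffAt_snd)
    exact contMDiffAt_mul ((contMDiffAt_chartAt e).comp (e, t) contMDiffAt_fst)
      (contMDiffAt_mk contMDiffAt_const contMDiffAt_const h2)
  refine ((contMDiff_proj (lattice k)).contMDiffAt.comp (e, t) h1).congr_of_eventuallyEq ?_
  filter_upwards [continuous_fst.continuousAt.preimage_mem_nhds
    ((chartAt Heis e).open_source.mem_nhds (mem_chart_source Heis e))] with p hp
  conv_lhs => rw [← proj_chartAt hp, circleAct_proj_logAt k _ t]
  rfl

/-- The subset of the torus over which the bundle is trivialized. -/
def trivDomain (u₀ : Circle × Circle) : Set (Circle × Circle) :=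
  Circle.logDomain u₀.1 ×ˢ Circle.logDomain u₀.2

/-- The section of `E_k → T²` given by logarithms around `u₀`. -/
def localSection (u₀ u : Circle × Circle) : HeisNil k :=
  proj (lattice k) (mk (Circle.logAt u₀.1 u.1) (Circle.logAt u₀.2 u.2) 0)

theorem toTorus_localSection (u₀ u : Circle × Circle) : toTorus k (localSection k u₀ u) = u :=
  Prod.ext (Circle.exp_logAt _ _) (Circle.exp_logAt _ _)

theorem contMDiffAt_localSection {u₀ u : Circle × Circle} (hu : u ∈ trivDomain u₀) :
    ContMDiffAt ((𝓡 1).prod (𝓡 1)) 𝓘(ℝ, Heis) ∞ (localSection k u₀) u :=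
  (contMDiff_proj (lattice k)).contMDiffAt.comp u (contMDiffAt_mk
    ((Circle.contMDiffAt_logAt hu.1).comp u contMDiffAt_fst)
    ((Circle.contMDiffAt_logAt hu.2).comp u contMDiffAt_snd) contMDiffAt_const)

/-- The fibre coordinate of the point of `E_k` represented by `g`, relative to the section
`localSection k u₀`. -/
def fibreCoordLift (u₀ : Circle × Circle) (g : Heis) : Circle :=
  Circle.exp (2 * Real.pi * (2 * (k : ℕ) * (z g - (1 / 2) *
    (x g * Circle.logAt u₀.2 (Circle.exp (2 * Real.pi * y g)) -
      y g * Circle.logAt u₀.1 (Circle.exp (2 * Real.pi * x g))))))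

/-- If `(a, b)` are the logarithms of the image of `g = (x, y, z)` in the torus, then `x - a` and
`y - b` are integers and `g = (x - a, y - b, 0) (a, b, z - (x b - y a) / 2)`. -/
theorem circleAct_localSection_fibreCoordLift (u₀ : Circle × Circle) (g : Heis) :
    circleAct k (localSection k u₀ (toTorus k (proj (lattice k) g))) (fibreCoordLift k u₀ g) =
      proj (lattice k) g := by
  have hk := two_mul_pos k
  set a := Circle.logAt u₀.1 (Circle.exp (2 * Real.pi * x g)) with ha
  set b := Circle.logAt u₀.2 (Circle.exp (2 * Real.pi * y g)) with hb
  obtain ⟨m, hm⟩ := Circle.exp_two_pi_mul_eq_iff.1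
    (Circle.exp_logAt u₀.1 (Circle.exp (2 * Real.pi * x g))).symm
  obtain ⟨n, hn⟩ := Circle.exp_two_pi_mul_eq_iff.1
    (Circle.exp_logAt u₀.2 (Circle.exp (2 * Real.pi * y g))).symm
  rw [← ha] at hm
  rw [← hb] at hn
  refine (circleAct_proj_of_exp k rfl _).trans ?_
  rw [mul_mk_zero_zero, proj_eq_proj]
  refine ⟨mk m n 0, ⟨⟨m, rfl⟩, ⟨n, rfl⟩, 0, by simp⟩, ?_⟩
  rw [toTorus_proj, ← ha, ← hb]
  ext
  · simp only [mul_def, x_mk]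
    rw [hm]
    ring
  · simp only [mul_def, y_mk]
    rw [hn]
    ring
  · simp only [mul_def, z_mk, x_mk, y_mk]
    rw [mul_div_cancel_left₀ _ hk.ne', hm, hn]
    ring

/-- The fibre coordinate on `E_k` relative to the section `localSection k u₀`. -/
def fibreCoord (u₀ : Circle × Circle) (e : HeisNil k) : Circle := fibreCoordLift k u₀ e.out

theorem circleAct_localSection_fibreCoord (u₀ : Circle × Circle) (e : HeisNil k) :
    circleAct k (localSection k u₀ (toTorus k e)) (fibreCoord k u₀ e) = e := by
  have h : proj (lattice k) e.out = e := Quotient.out_eq e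
  have h1 := circleAct_localSection_fibreCoordLift k u₀ e.out
  rw [h] at h1
  exact h1

theorem fibreCoord_circleAct (u₀ u : Circle × Circle) (t : Circle) :
    fibreCoord k u₀ (circleAct k (localSection k u₀ u) t) = t := by
  apply circleAct_injective k (localSection k u₀ u)
  have h := circleAct_localSection_fibreCoord k u₀ (circleAct k (localSection k u₀ u) t)
  rwa [toTorus_circleAct, toTorus_localSection] at h

theorem fibreCoord_proj (u₀ : Circle × Circle) (g : Heis) :
    fibreCoord k u₀ (proj (lattice k) g) = fibreCoordLift k u₀ g := by
  rw [← circleAct_localSection_fibreCoordLift k u₀ g, fibreCoord_circleAct]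

theorem contMDiffAt_fibreCoord {u₀ : Circle × Circle} {e : HeisNil k}
    (he : toTorus k e ∈ trivDomain u₀) :
    ContMDiffAt 𝓘(ℝ, Heis) (𝓡 1) ∞ (fibreCoord k u₀) e := by
  apply contMDiffAt_of_comp_proj
  rintro g rfl
  have h : fibreCoord k u₀ ∘ proj (lattice k) = fibreCoordLift k u₀ :=
    funext (fibreCoord_proj k u₀)
  rw [h]
  have ha : ContMDiffAt 𝓘(ℝ, Heis) 𝓘(ℝ, ℝ) ∞
      (fun g => Circle.logAt u₀.1 (Circle.exp (2 * Real.pi * x g))) g :=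
    (Circle.contMDiffAt_logAt he.1).comp g
      (contMDiff_circleExp_two_pi.comp contMDiff_x).contMDiffAt
  have hb : ContMDiffAt 𝓘(ℝ, Heis) 𝓘(ℝ, ℝ) ∞
      (fun g => Circle.logAt u₀.2 (Circle.exp (2 * Real.pi * y g))) g :=
    (Circle.contMDiffAt_logAt he.2).comp g
      (contMDiff_circleExp_two_pi.comp contMDiff_y).contMDiffAt
  rw [contMDiffAt_iff_contDiffAt] at ha hb
  have h1 : ContDiffAt ℝ ∞ (fun g : Heis => 2 * (k : ℕ) * (z g - (1 / 2) *
    (x g * Circle.logAt u₀.2 (Circle.exp (2 * Real.pi * y g)) -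
      y g * Circle.logAt u₀.1 (Circle.exp (2 * Real.pi * x g))))) g :=
    contDiffAt_const.mul (z.contDiff.contDiffAt.sub (contDiffAt_const.mul
      ((x.contDiff.contDiffAt.mul hb).sub (y.contDiff.contDiffAt.mul ha))))
  exact contMDiff_circleExp_two_pi.contMDiffAt.comp g h1.contMDiffAt

theorem contMDiffOn_circleAct_localSection (u₀ : Circle × Circle) :
    ContMDiffOn (((𝓡 1).prod (𝓡 1)).prod (𝓡 1)) 𝓘(ℝ, Heis) ∞
      (fun p : (Circle × Circle) × Circle => circleAct k (localSection k u₀ p.1) p.2)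
      (trivDomain u₀ ×ˢ Set.univ) := by
  intro p hp
  have h1 : ContMDiffAt (((𝓡 1).prod (𝓡 1)).prod (𝓡 1)) (𝓘(ℝ, Heis).prod (𝓡 1)) ∞
      (fun p : (Circle × Circle) × Circle => (localSection k u₀ p.1, p.2)) p :=
    ((contMDiffAt_localSection k hp.1).comp p contMDiffAt_fst).prodMk contMDiffAt_snd
  exact ((contMDiff_circleAct k).contMDiffAt.comp p h1).contMDiffWithinAt

theorem contMDiffOn_toTorus_fibreCoord (u₀ : Circle × Circle) :
    ContMDiffOn 𝓘(ℝ, Heis) (((𝓡 1).prod (𝓡 1)).prod (𝓡 1)) ∞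
      (fun e : HeisNil k => (toTorus k e, fibreCoord k u₀ e)) (toTorus k ⁻¹' trivDomain u₀) :=
  fun _ he => ((contMDiff_toTorus k).contMDiffAt.prodMk
    (contMDiffAt_fibreCoord k he)).contMDiffWithinAt

/-- The local trivialization of `E_k → T²` around `u₀`. -/
def localTriv (u₀ : Circle × Circle) :
    PartialDiffeomorph (((𝓡 1).prod (𝓡 1)).prod (𝓡 1)) 𝓘(ℝ, Heis)
      ((Circle × Circle) × Circle) (HeisNil k) ∞ where
  toFun p := circleAct k (localSection k u₀ p.1) p.2
  invFun e := (toTorus k e, fibreCoord k u₀ e)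
  source := trivDomain u₀ ×ˢ Set.univ
  target := toTorus k ⁻¹' trivDomain u₀
  map_source' p hp := by
    rw [Set.mem_preimage, toTorus_circleAct, toTorus_localSection]
    exact hp.1
  map_target' e he := ⟨he, trivial⟩
  left_inv' p _ := by
    rw [toTorus_circleAct, toTorus_localSection, fibreCoord_circleAct]
  right_inv' e _ := circleAct_localSection_fibreCoord k u₀ e
  open_source :=
    ((Circle.isOpen_logDomain _).prod (Circle.isOpen_logDomain _)).prod isOpen_univ
  open_target := ((Circle.isOpen_logDomain _).prod (Circle.isOpen_logDomain _)).preimage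
    (contMDiff_toTorus k).continuous
  contMDiffOn_toFun := contMDiffOn_circleAct_localSection k u₀
  contMDiffOn_invFun := contMDiffOn_toTorus_fibreCoord k u₀

theorem isPrincipalBundle : IsPrincipalBundle 𝓘(ℝ, Heis) ((𝓡 1).prod (𝓡 1)) (𝓡 1)
    (toTorus k) (circleAct k) where
  contMDiff_proj := contMDiff_toTorus k
  contMDiff_act := contMDiff_circleAct k
  act_one := circleAct_one k
  act_mul := circleAct_mul k
  locally_trivial u₀ := by
    refine ⟨trivDomain u₀, localTriv k u₀,
      (Circle.isOpen_logDomain _).prod (Circle.isOpen_logDomain _),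
      ⟨Circle.mem_logDomain_self _, Circle.mem_logDomain_self _⟩, rfl, rfl, ?_, ?_⟩
    · intro u _ t
      exact (toTorus_circleAct k _ t).trans (toTorus_localSection k u₀ u)
    · intro u _ s t
      exact circleAct_mul k (localSection k u₀ u) s t

/-- Vectors tangent to the fibres of `E_k → T²` are those in the direction of the center. -/
theorem coord_eq_zero_of_mfderiv_toTorus {g v : Heis}
    (h : mfderiv 𝓘(ℝ, Heis) ((𝓡 1).prod (𝓡 1)) (toTorus k) (proj (lattice k) g)
      (projDeriv (Λ := lattice k) g v) = 0) : x v = 0 ∧ y v = 0 := by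
  have hq := (contMDiff_toTorus k).mdifferentiable (by simp) (proj (lattice k) g)
  -- A function on the torus composed with `H₃ → E_k → T²` has zero derivative along `v`.
  have key : ∀ f : Circle × Circle → ℂ, ContMDiff ((𝓡 1).prod (𝓡 1)) 𝓘(ℝ, ℂ) ∞ f →
      fderiv ℝ (f ∘ toTorus k ∘ proj (lattice k)) g v = 0 := by
    intro f hf
    have hf' := hf.mdifferentiable (by simp) (toTorus k (proj (lattice k) g))
    rw [← mfderiv_eq_fderiv, mfderiv_comp g hf' (hq.comp g (mdifferentiable_proj (lattice k) g)),
      mfderiv_comp g hq (mdifferentiable_proj (lattice k) g)]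
    rw [projDeriv_apply] at h
    have h2 := congrArg (mfderiv ((𝓡 1).prod (𝓡 1)) 𝓘(ℝ, ℂ) f (toTorus k (proj (lattice k) g))) h
    rw [map_zero] at h2
    exact h2
  have key2 : ∀ c : Heis →L[ℝ] ℝ,
      fderiv ℝ (fun g => ((Circle.exp (2 * Real.pi * c g) : Circle) : ℂ)) g v = 0 → c v = 0 := by
    intro c hc
    have h1 : HasFDerivAt (fun g : Heis => Complex.exp (((2 * Real.pi * c g : ℝ) : ℂ) * Complex.I))
        (Complex.exp (((2 * Real.pi * c g : ℝ) : ℂ) * Complex.I) •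
          ((Complex.ofRealCLM.comp ((2 * Real.pi) • c)).smulRight Complex.I)) g := by
      have h3 : HasFDerivAt (fun g : Heis => ((2 * Real.pi * c g : ℝ) : ℂ) * Complex.I)
          ((Complex.ofRealCLM.comp ((2 * Real.pi) • c)).smulRight Complex.I) g :=
        ContinuousLinearMap.hasFDerivAt
          ((Complex.ofRealCLM.comp ((2 * Real.pi) • c)).smulRight Complex.I)
      exact h3.cexp
    have h4 : (fun g => ((Circle.exp (2 * Real.pi * c g) : Circle) : ℂ)) =
        fun g : Heis => Complex.exp (((2 * Real.pi * c g : ℝ) : ℂ) * Complex.I) :=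
      funext fun g => Circle.coe_exp _
    rw [h4, h1.fderiv] at hc
    simpa [Complex.exp_ne_zero, Real.pi_ne_zero] using hc
  exact ⟨key2 x (key (fun u => (u.1 : ℂ)) (Circle.contMDiff_coe.comp contMDiff_fst)),
    key2 y (key (fun u => (u.2 : ℂ)) (Circle.contMDiff_coe.comp contMDiff_snd))⟩

end Heis

/-! ### Maps between quotients of Lie groups -/

namespace CosetSpace

section Charts

variable {G : Type*} [NormedAddCommGroup G] [NormedSpace ℝ G] [LocallyCompactSpace G]
  [Group G] [IsTopologicalGroup G] [LieGroup 𝓘(ℝ, G) ∞ G]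
  {Λ : Subgroup G} [DiscreteTopology Λ]
  {G' : Type*} [NormedAddCommGroup G'] [NormedSpace ℝ G'] [LocallyCompactSpace G']
  [Group G'] [IsTopologicalGroup G'] [LieGroup 𝓘(ℝ, G') ∞ G']
  {Λ' : Subgroup G'} [DiscreteTopology Λ']

variable (Λ) in
/-- Around any given point of `G`, the quotient map `G → Λ \ G` is the inverse of a chart. -/
theorem exists_chart (g : G) {V : Set G} (hV : IsOpen V) (hg : g ∈ V) :
    ∃ φ : OpenPartialHomeomorph (CosetSpace Λ) G,
      φ ∈ IsManifold.maximalAtlas 𝓘(ℝ, G) ∞ (CosetSpace Λ) ∧ g ∈ φ.target ∧ φ.target ⊆ V ∧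
      ∀ u ∈ φ.target, φ.symm u = proj Λ u := by
  obtain ⟨Φ, hgΦ, hΦ⟩ := isLocalDiffeomorph_proj Λ g
  let ψ := Φ.toOpenPartialHomeomorph.restrOpen V hV
  have hs : ψ.source = Φ.source ∩ V := rfl
  have ht : ψ.target ⊆ Φ.target := fun u hu => hu.1
  refine ⟨ψ.symm, ψ.symm.mem_maximalAtlas_of_contMDiffOn ?_ ?_, ⟨hgΦ, hg⟩,
    fun u hu => hu.2, fun u hu => (hΦ hu.1).symm⟩
  · exact Φ.contMDiffOn_invFun.mono ht
  · exact Φ.contMDiffOn_toFun.mono fun u hu => hu.1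

theorem mfderiv_projDeriv {f : CosetSpace Λ → CosetSpace Λ'} {A : G →L[ℝ] G'}
    (hf : MDifferentiable 𝓘(ℝ, G) 𝓘(ℝ, G') f) (hA : f ∘ proj Λ = proj Λ' ∘ A) (g v : G) :
    (mfderiv 𝓘(ℝ, G) 𝓘(ℝ, G') f (proj Λ g) : G →L[ℝ] G') (projDeriv (Λ := Λ) g v) =
      projDeriv (Λ := Λ') (A g) (A v) := by
  have h1 := mfderiv_comp g (hf (proj Λ g)) (mdifferentiable_proj Λ g)
  have h2 := mfderiv_comp (I := 𝓘(ℝ, G)) (I' := 𝓘(ℝ, G')) (I'' := 𝓘(ℝ, G')) g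
    (mdifferentiable_proj Λ' (A g)) (A.differentiableAt.mdifferentiableAt)
  rw [hA, h2, mfderiv_eq_fderiv, A.fderiv] at h1
  rw [projDeriv_apply, projDeriv_apply]
  exact (congrArg (fun B : G →L[ℝ] G' => B v) h1).symm

/-- Pullbacks under maps between quotients can be computed on the groups. -/
theorem pullback_pullback_proj {n : ℕ} (η : DiffForm 𝓘(ℝ, G') (CosetSpace Λ') n)
    {f : CosetSpace Λ → CosetSpace Λ'} {f' : G → G'}
    (hf : MDifferentiable 𝓘(ℝ, G) 𝓘(ℝ, G') f) (hf' : MDifferentiable 𝓘(ℝ, G) 𝓘(ℝ, G') f')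
    (h : f ∘ proj Λ = proj Λ' ∘ f') :
    (η.pullback 𝓘(ℝ, G) 𝓘(ℝ, G') f).pullback 𝓘(ℝ, G) 𝓘(ℝ, G) (proj Λ) =
      (η.pullback 𝓘(ℝ, G') 𝓘(ℝ, G') (proj Λ')).pullback 𝓘(ℝ, G) 𝓘(ℝ, G') f' := by
  rw [DiffForm.pullback_pullback η hf (mdifferentiable_proj Λ), h,
    DiffForm.pullback_pullback η (mdifferentiable_proj Λ') hf']

/-- A form on `Λ \ G` whose pullback to `G` is left invariant is invariant under the maps covered by
translations by central elements. -/
theorem pullback_eq_of_central {n : ℕ} {η : DiffForm 𝓘(ℝ, G) (CosetSpace Λ) n}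
    (hη : (η.pullback 𝓘(ℝ, G) 𝓘(ℝ, G) (proj Λ)).IsLeftInvariant)
    {f : CosetSpace Λ → CosetSpace Λ} (hf : MDifferentiable 𝓘(ℝ, G) 𝓘(ℝ, G) f)
    {c : G} (hc : ∀ g, c * g = g * c) (h : ∀ g, f (proj Λ g) = proj Λ (g * c)) :
    η.pullback 𝓘(ℝ, G) 𝓘(ℝ, G) f = η := by
  apply eq_of_pullback_eq
  rw [pullback_pullback_proj (f' := fun g => c * g) η hf
    ((contMDiff_mul_left (I := 𝓘(ℝ, G)) (n := ∞) (a := c)).mdifferentiable (by simp))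
    (funext fun g => by simp only [Function.comp_apply, h, hc])]
  exact hη c

theorem apply_eq_pullback_proj {n : ℕ} (η : DiffForm 𝓘(ℝ, G) (CosetSpace Λ) n) (g : G)
    (v : Fin n → G) : (η (proj Λ g) : G [⋀^Fin n]→L[ℝ] ℝ) v =
      (η.pullback 𝓘(ℝ, G) 𝓘(ℝ, G) (proj Λ) g : G [⋀^Fin n]→L[ℝ] ℝ)
        (fun i => (projDeriv (Λ := Λ) g).symm (v i)) := by
  rw [pullback_proj_apply]
  simp only [ContinuousLinearEquiv.apply_symm_apply]

end Charts

theorem compactSpace_of_forall_exists {G : Type*} [Group G] [TopologicalSpace G] {Λ : Subgroup G}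
    {K : Set G} (hK : IsCompact K) (h : ∀ g : G, ∃ l ∈ Λ, l * g ∈ K) :
    CompactSpace (CosetSpace Λ) := by
  refine ⟨?_⟩
  convert! hK.image (continuous_quotient_mk' : Continuous (proj Λ))
  refine (Set.eq_univ_of_forall fun x => ?_).symm
  obtain ⟨g, rfl⟩ := proj_surjective x
  obtain ⟨l, hl, hlg⟩ := h g
  exact ⟨l * g, hlg, proj_mul hl g⟩

end CosetSpace

/-! ### The nilmanifolds `E_k` and the forms induced on them -/

open CosetSpace

namespace Heis

theorem mk_zero_zero_mul (c : ℝ) (g : Heis) : mk 0 0 c * g = g * mk 0 0 c := by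
  ext <;> simp [mul_def, add_comm]

theorem isNilpotent : Group.IsNilpotent Heis := by
  let f : Heis →* Multiplicative (ℝ × ℝ) :=
    { toFun := fun g => Multiplicative.ofAdd (x g, y g)
      map_one' := rfl
      map_mul' := fun _ _ => rfl }
  refine Subgroup.isNilpotent_of_ker_le_center f fun g hg => ?_
  rw [Subgroup.mem_center_iff]
  intro h
  have hx : x g = 0 := congrArg Prod.fst (Multiplicative.ofAdd.injective hg)
  have hy : y g = 0 := congrArg Prod.snd (Multiplicative.ofAdd.injective hg)
  ext <;> simp [mul_def, hx, hy, add_comm]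

theorem sub_floor_mem (r : ℝ) : ((-⌊r⌋ : ℤ) : ℝ) + r ∈ Set.Icc (0 : ℝ) 1 := by
  push_cast
  constructor
  · linarith [Int.floor_le r]
  · linarith [Int.lt_floor_add_one r]

theorem mk_mem_lattice_of_int (k : ℕ+) (a b c : ℤ) : mk a b c ∈ lattice k := by
  have hk := two_mul_pos k
  refine ⟨⟨a, rfl⟩, ⟨b, rfl⟩, c * (2 * (k : ℕ)), ?_⟩
  push_cast
  rw [mul_div_cancel_right₀ _ hk.ne']
  rfl

instance compactSpace (k : ℕ+) : CompactSpace (HeisNil k) := by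
  refine compactSpace_of_forall_exists (K := Set.Icc (0 : ℝ) 1 ×ˢ (Set.Icc (0 : ℝ) 1 ×ˢ
    Set.Icc (0 : ℝ) 1)) (isCompact_Icc.prod (isCompact_Icc.prod isCompact_Icc)) fun g => ?_
  set a : ℤ := -⌊x g⌋
  set b : ℤ := -⌊y g⌋
  refine ⟨mk a b (-⌊z g + (a * y g - b * x g) / 2⌋ : ℤ), mk_mem_lattice_of_int k _ _ _,
    sub_floor_mem (x g), sub_floor_mem (y g), ?_⟩
  have h := sub_floor_mem (z g + (a * y g - b * x g) / 2)
  rw [← add_assoc] at h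
  exact h

theorem isNilmanifold (k : ℕ+) :
    IsNilmanifold 𝓘(ℝ, Heis) 𝓘(ℝ, Heis) (lattice k) (proj (lattice k)) where
  simplyConnected := inferInstance
  nilpotent := isNilpotent
  discrete := inferInstance
  compact := inferInstance
  surjective := proj_surjective
  eq_iff _ _ := proj_eq_proj
  isLocalDiffeomorph := isLocalDiffeomorph_proj _

variable (k : ℕ+) (c : ℝ)

theorem pullback_proj_induced_vol :
    (DiffForm.induced (lattice k) (c • vol)).pullback 𝓘(ℝ, Heis) 𝓘(ℝ, Heis) (proj (lattice k)) =
      c • vol :=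
  pullback_proj_induced (isLeftInvariant_vol.const_smul c)

theorem isSmooth_induced_vol : (DiffForm.induced (lattice k) (c • vol)).IsSmooth :=
  isSmooth_of_pullback (contDiff_smul_vol c) (pullback_proj_induced_vol k c)

theorem d_induced_vol : (DiffForm.induced (lattice k) (c • vol)).d = 0 :=
  d_eq_of_pullback (pullback_proj_induced_vol k c) (extDeriv_smul_vol c).symm

theorem circleAct_invariant_induced_vol (t : Circle) :
    (DiffForm.induced (lattice k) (c • vol)).pullback 𝓘(ℝ, Heis) 𝓘(ℝ, Heis)
      (fun e => circleAct k e t) = DiffForm.induced (lattice k) (c • vol) := by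
  refine pullback_eq_of_central (c := mk 0 0 (Circle.logAt 1 t / (2 * (k : ℕ)))) ?_ ?_
    (mk_zero_zero_mul _) fun g => circleAct_proj_logAt k g 1 t
  · rw [pullback_proj_induced_vol]
    exact isLeftInvariant_vol.const_smul c
  · exact ((contMDiff_circleAct k).comp (contMDiff_id.prodMk contMDiff_const)).mdifferentiable
      (by simp)

theorem isAdmissible_induced_vol :
    (DiffForm.induced (lattice k) (c • vol)).IsAdmissible ((𝓡 1).prod (𝓡 1)) (toTorus k) := by
  intro e X Y Z hX hY
  obtain ⟨g, rfl⟩ := proj_surjective e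
  obtain ⟨X', rfl⟩ := (projDeriv (Λ := lattice k) g).surjective X
  obtain ⟨Y', rfl⟩ := (projDeriv (Λ := lattice k) g).surjective Y
  obtain ⟨hX1, hX2⟩ := coord_eq_zero_of_mfderiv_toTorus k hX
  obtain ⟨hY1, hY2⟩ := coord_eq_zero_of_mfderiv_toTorus k hY
  refine (apply_eq_pullback_proj _ g _).trans ?_
  rw [pullback_proj_induced_vol]
  refine (congrArg (c * ·) (vol_apply g _)).trans ?_
  rw [Matrix.det_fin_three]
  simp [hX1, hX2, hY1, hY2]

end Heis

/-! ### The correspondence space as a nilmanifold -/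

namespace CorrGroup

theorem isNilpotent : Group.IsNilpotent CorrGroup := by
  let f : CorrGroup →* Multiplicative (ℝ × ℝ) :=
    { toFun := fun g => Multiplicative.ofAdd (Heis.x (fst g), Heis.y (fst g))
      map_one' := rfl
      map_mul' := fun _ _ => rfl }
  refine Subgroup.isNilpotent_of_ker_le_center f fun g hg => ?_
  rw [Subgroup.mem_center_iff]
  intro h
  have hx : Heis.x (fst g) = 0 := congrArg Prod.fst (Multiplicative.ofAdd.injective hg)
  have hy : Heis.y (fst g) = 0 := congrArg Prod.snd (Multiplicative.ofAdd.injective hg)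
  ext <;> simp [Heis.mul_def, hx, hy, add_comm]

variable (k j : ℕ+)

instance compactSpace : CompactSpace (HeisCorr k j) := by
  refine compactSpace_of_forall_exists (K := Set.Icc (0 : ℝ) 1 ×ˢ (Set.Icc (0 : ℝ) 1 ×ˢ
    (Set.Icc (0 : ℝ) 1 ×ˢ Set.Icc (0 : ℝ) 1)))
    (isCompact_Icc.prod (isCompact_Icc.prod (isCompact_Icc.prod isCompact_Icc))) fun g => ?_
  set x := Heis.x (fst g)
  set y := Heis.y (fst g)
  set a : ℤ := -⌊x⌋
  set b : ℤ := -⌊y⌋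
  refine ⟨mk a b (-⌊Heis.z (fst g) + (a * y - b * x) / 2⌋ : ℤ)
    (-⌊Heis.z (snd g) + (a * y - b * x) / 2⌋ : ℤ),
    ⟨Heis.mk_mem_lattice_of_int k _ _ _, Heis.mk_mem_lattice_of_int j _ _ _⟩,
    Heis.sub_floor_mem x, Heis.sub_floor_mem y, ?_, ?_⟩
  · have h := Heis.sub_floor_mem (Heis.z (fst g) + (a * y - b * x) / 2)
    rw [← add_assoc] at h
    exact h
  · have h := Heis.sub_floor_mem (Heis.z (snd g) + (a * y - b * x) / 2)
    rw [← add_assoc] at h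
    exact h

theorem isNilmanifold : IsNilmanifold 𝓘(ℝ, CorrGroup) 𝓘(ℝ, CorrGroup) (lattice k j)
    (proj (lattice k j)) where
  simplyConnected := inferInstance
  nilpotent := isNilpotent
  discrete := inferInstance
  compact := inferInstance
  surjective := proj_surjective
  eq_iff _ _ := proj_eq_proj
  isLocalDiffeomorph := isLocalDiffeomorph_proj _

theorem toLeft_comp_proj : toLeft k j ∘ proj (lattice k j) = proj (Heis.lattice k) ∘ fst := rfl
theorem toRight_comp_proj : toRight k j ∘ proj (lattice k j) = proj (Heis.lattice j) ∘ snd := rfl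

theorem contMDiff_toLeft : ContMDiff 𝓘(ℝ, CorrGroup) 𝓘(ℝ, Heis) ∞ (toLeft k j) :=
  contMDiff_of_comp_proj ((contMDiff_proj (Heis.lattice k)).comp fst.contDiff.contMDiff)

theorem contMDiff_toRight : ContMDiff 𝓘(ℝ, CorrGroup) 𝓘(ℝ, Heis) ∞ (toRight k j) :=
  contMDiff_of_comp_proj ((contMDiff_proj (Heis.lattice j)).comp snd.contDiff.contMDiff)

/-! ### The correspondence space is the fibre product -/

/-- The inclusion `(a, b) ↦ (a, b, 0)` of `ℝ²` into `H₃`. -/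
def horizontal : ℝ × ℝ →L[ℝ] Heis :=
  (ContinuousLinearMap.fst ℝ ℝ ℝ).prod ((ContinuousLinearMap.snd ℝ ℝ ℝ).prod 0)

/-- The decomposition `H₃ × H₃ = C ⊕ ℝ²` of vector spaces, where `(a, b)` corresponds to
`((0, 0, 0), (a, b, 0))`. -/
def complementEquiv : (CorrGroup × (ℝ × ℝ)) ≃L[ℝ] Heis × Heis :=
  ContinuousLinearEquiv.equivOfInverse
    ((fst.comp (ContinuousLinearMap.fst ℝ CorrGroup (ℝ × ℝ))).prod
      (snd.comp (ContinuousLinearMap.fst ℝ CorrGroup (ℝ × ℝ)) +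
        horizontal.comp (ContinuousLinearMap.snd ℝ CorrGroup (ℝ × ℝ))))
    (((Heis.x.comp (ContinuousLinearMap.fst ℝ Heis Heis)).prod
        ((Heis.y.comp (ContinuousLinearMap.fst ℝ Heis Heis)).prod
          ((Heis.z.comp (ContinuousLinearMap.fst ℝ Heis Heis)).prod
            (Heis.z.comp (ContinuousLinearMap.snd ℝ Heis Heis)))) :
        Heis × Heis →L[ℝ] CorrGroup).prod
      ((Heis.x.comp (ContinuousLinearMap.snd ℝ Heis Heis) -
          Heis.x.comp (ContinuousLinearMap.fst ℝ Heis Heis)).prod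
        (Heis.y.comp (ContinuousLinearMap.snd ℝ Heis Heis) -
          Heis.y.comp (ContinuousLinearMap.fst ℝ Heis Heis))))
    (by
      rintro ⟨⟨x, y, z, z'⟩, a, b⟩
      refine Prod.ext (Prod.ext rfl (Prod.ext rfl (Prod.ext rfl ?_))) (Prod.ext ?_ ?_)
      · exact add_zero z'
      · exact add_sub_cancel_left x a
      · exact add_sub_cancel_left y b)
    (by
      rintro ⟨⟨x, y, z⟩, x', y', z'⟩
      refine Prod.ext rfl (Prod.ext ?_ (Prod.ext ?_ ?_))
      · exact add_sub_cancel x x'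
      · exact add_sub_cancel y y'
      · exact add_zero z')

theorem complementEquiv_apply_zero (u : CorrGroup) : complementEquiv (u, 0) = (fst u, snd u) := by
  refine Prod.ext rfl ?_
  change snd u + horizontal 0 = snd u
  rw [map_zero, add_zero]

/-- In the charts given by local inverses of the quotient maps, `C → H₃ × H₃` is the linear inclusion
of a direct summand. -/
theorem isImmersion_prod : Manifold.IsImmersion 𝓘(ℝ, CorrGroup) (𝓘(ℝ, Heis).prod 𝓘(ℝ, Heis)) ∞
    (fun w => (toLeft k j w, toRight k j w)) := by
  refine ⟨ℝ × ℝ, inferInstance, inferInstance, fun w => ?_⟩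
  obtain ⟨g, rfl⟩ := proj_surjective w
  obtain ⟨φ₁, hφ₁, hg₁, -, h₁⟩ := exists_chart (Heis.lattice k) (fst g) isOpen_univ trivial
  obtain ⟨φ₂, hφ₂, hg₂, -, h₂⟩ := exists_chart (Heis.lattice j) (snd g) isOpen_univ trivial
  obtain ⟨ψ, hψ, hg, hsub, h⟩ := exists_chart (lattice k j) g
    ((φ₁.open_target.preimage fst.continuous).inter (φ₂.open_target.preimage snd.continuous))
    ⟨hg₁, hg₂⟩
  refine Manifold.IsImmersionAtOfComplement.mk_of_continuousAt
    (((contMDiff_toLeft k j).continuous.prodMk (contMDiff_toRight k j).continuous).continuousAt)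
    complementEquiv ψ (φ₁.prod φ₂) ?_ ⟨?_, ?_⟩ hψ (IsManifold.mem_maximalAtlas_prod hφ₁ hφ₂) ?_
  · rw [← h g hg]
    exact ψ.map_target hg
  · change proj (Heis.lattice k) (fst g) ∈ φ₁.source
    rw [← h₁ _ hg₁]
    exact φ₁.map_target hg₁
  · change proj (Heis.lattice j) (snd g) ∈ φ₂.source
    rw [← h₂ _ hg₂]
    exact φ₂.map_target hg₂
  · intro u hu
    have hu : u ∈ ψ.target := by simpa using hu
    obtain ⟨hu₁, hu₂⟩ := hsub hu
    change (φ₁ (toLeft k j (ψ.symm u)), φ₂ (toRight k j (ψ.symm u))) = complementEquiv (u, 0)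
    rw [complementEquiv_apply_zero, h u hu]
    change (φ₁ (proj (Heis.lattice k) (fst u)), φ₂ (proj (Heis.lattice j) (snd u))) = _
    rw [← h₁ _ hu₁, ← h₂ _ hu₂, φ₁.right_inv hu₁, φ₂.right_inv hu₂]

theorem injective_prod : Function.Injective (fun w => (toLeft k j w, toRight k j w)) := by
  intro w w' h
  obtain ⟨g, rfl⟩ := proj_surjective w
  obtain ⟨g', rfl⟩ := proj_surjective w'
  obtain ⟨l, hl, e⟩ := proj_eq_proj.1 (congrArg Prod.fst h :
    proj (Heis.lattice k) (fst g) = proj (Heis.lattice k) (fst g'))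
  obtain ⟨m, hm, f⟩ := proj_eq_proj.1 (congrArg Prod.snd h :
    proj (Heis.lattice j) (snd g) = proj (Heis.lattice j) (snd g'))
  -- The lattice elements `l` and `m` have the same first two coordinates: `(l, m)` lies in `C`.
  have hx : Heis.x l = Heis.x m := by
    have h1 : Heis.x l + Heis.x (fst g) = Heis.x (fst g') := congrArg Heis.x e
    have h2 : Heis.x m + Heis.x (fst g) = Heis.x (fst g') := congrArg Heis.x f
    linarith
  have hy : Heis.y l = Heis.y m := by
    have h1 : Heis.y l + Heis.y (fst g) = Heis.y (fst g') := congrArg Heis.y e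
    have h2 : Heis.y m + Heis.y (fst g) = Heis.y (fst g') := congrArg Heis.y f
    linarith
  have hfst : fst (ofPair l m) = l := rfl
  have hsnd : snd (ofPair l m) = m := Heis.ext hx hy rfl
  refine proj_eq_proj.2 ⟨ofPair l m, ⟨?_, ?_⟩, ext ?_ ?_⟩
  · exact hl
  · change snd (ofPair l m) ∈ Heis.lattice j
    rwa [hsnd]
  · rw [fst_mul, hfst, e]
  · rw [snd_mul, hsnd, f]

theorem range_prod : Set.range (fun w => (toLeft k j w, toRight k j w)) =
    {p : HeisNil k × HeisNil j | Heis.toTorus k p.1 = Heis.toTorus j p.2} := by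
  ext ⟨a, b⟩
  constructor
  · rintro ⟨w, hw⟩
    obtain ⟨g, rfl⟩ := proj_surjective w
    rw [← hw]
    rfl
  · intro h
    obtain ⟨g, rfl⟩ := proj_surjective a
    obtain ⟨g', rfl⟩ := proj_surjective b
    obtain ⟨m, hm⟩ := Circle.exp_two_pi_mul_eq_iff.1 (congrArg Prod.fst h :
      Circle.exp (2 * Real.pi * Heis.x g) = Circle.exp (2 * Real.pi * Heis.x g'))
    obtain ⟨n, hn⟩ := Circle.exp_two_pi_mul_eq_iff.1 (congrArg Prod.snd h :
      Circle.exp (2 * Real.pi * Heis.y g) = Circle.exp (2 * Real.pi * Heis.y g'))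
    -- A translate of `g'` by an element of `Λ_j` has the same first two coordinates as `g`.
    have hl : Heis.mk m n (0 : ℤ) ∈ Heis.lattice j := Heis.mk_mem_lattice_of_int j m n 0
    set l := Heis.mk m n (0 : ℤ)
    refine ⟨proj (lattice k j) (ofPair g (l * g')), Prod.ext rfl ?_⟩
    have hsnd : snd (ofPair g (l * g')) = l * g' := by
      refine Heis.ext ?_ ?_ rfl
      · exact hm.trans (add_comm _ _)
      · exact hn.trans (add_comm _ _)
    change proj (Heis.lattice j) (snd (ofPair g (l * g'))) = _
    rw [hsnd, proj_mul hl]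

theorem isFibreProduct : IsFibreProduct 𝓘(ℝ, CorrGroup) 𝓘(ℝ, Heis) 𝓘(ℝ, Heis)
    (Heis.toTorus k) (Heis.toTorus j) (toLeft k j) (toRight k j) where
  isSmoothEmbedding := ⟨isImmersion_prod k j,
    (((contMDiff_toLeft k j).continuous.prodMk
      (contMDiff_toRight k j).continuous).isClosedEmbedding (injective_prod k j)).isEmbedding⟩
  range_eq := range_prod k j

/-! ### The form `Ω₃ ∧ Ω̃₃` on the correspondence space -/

theorem pullback_proj_induced_fibreForm (c : ℝ) :
    (DiffForm.induced (lattice k j) (c • fibreForm)).pullback 𝓘(ℝ, CorrGroup) 𝓘(ℝ, CorrGroup)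
      (proj (lattice k j)) = c • fibreForm :=
  pullback_proj_induced (isLeftInvariant_fibreForm.const_smul c)

theorem mk_zero_zero_mul (s t : ℝ) (g : CorrGroup) : mk 0 0 s t * g = g * mk 0 0 s t := by
  ext1
  · exact Heis.mk_zero_zero_mul s (fst g)
  · exact Heis.mk_zero_zero_mul t (snd g)

/-- Translation by the central element `(0, 0, s, t)` on the correspondence space. -/
def centralShift (s t : ℝ) : HeisCorr k j → HeisCorr k j :=
  Quotient.map (fun g => g * mk 0 0 s t) (by
    rintro g h ⟨l, rfl⟩
    exact ⟨l, (mul_assoc (l : CorrGroup) h _).symm⟩)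

theorem contMDiff_centralShift (s t : ℝ) :
    ContMDiff 𝓘(ℝ, CorrGroup) 𝓘(ℝ, CorrGroup) ∞ (centralShift k j s t) :=
  contMDiff_of_comp_proj ((contMDiff_proj (lattice k j)).comp
    (contMDiff_mul_right (I := 𝓘(ℝ, CorrGroup)) (n := ∞) (a := mk 0 0 s t)))

theorem induced_fibreForm_invariant (c : ℝ) (s t : Circle) :
    ∃ a : HeisCorr k j → HeisCorr k j, ContMDiff 𝓘(ℝ, CorrGroup) 𝓘(ℝ, CorrGroup) ∞ a ∧
      (∀ w, toLeft k j (a w) = Heis.circleAct k (toLeft k j w) s) ∧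
      (∀ w, toRight k j (a w) = Heis.circleAct j (toRight k j w) t) ∧
      (DiffForm.induced (lattice k j) (c • fibreForm)).pullback 𝓘(ℝ, CorrGroup) 𝓘(ℝ, CorrGroup) a =
        DiffForm.induced (lattice k j) (c • fibreForm) := by
  refine ⟨centralShift k j (Circle.logAt 1 s / (2 * (k : ℕ))) (Circle.logAt 1 t / (2 * (j : ℕ))),
    contMDiff_centralShift k j _ _, fun w => ?_, fun w => ?_, ?_⟩
  · obtain ⟨g, rfl⟩ := proj_surjective w
    exact (Heis.circleAct_proj_logAt k (fst g) 1 s).symm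
  · obtain ⟨g, rfl⟩ := proj_surjective w
    exact (Heis.circleAct_proj_logAt j (snd g) 1 t).symm
  · refine pullback_eq_of_central ?_ ((contMDiff_centralShift k j _ _).mdifferentiable (by simp))
      (mk_zero_zero_mul _ _) fun g => rfl
    rw [pullback_proj_induced_fibreForm]
    exact isLeftInvariant_fibreForm.const_smul c

theorem induced_fibreForm_apply (c : ℝ) (g X Y : CorrGroup) :
    (DiffForm.induced (lattice k j) (c • fibreForm) (proj (lattice k j) g) :
      CorrGroup [⋀^Fin 2]→L[ℝ] ℝ) ![projDeriv (Λ := lattice k j) g X,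
        projDeriv (Λ := lattice k j) g Y] =
      c * (Heis.coframe (fst g) 2 (fst X) * Heis.coframe (snd g) 2 (snd Y) -
      Heis.coframe (snd g) 2 (snd X) * Heis.coframe (fst g) 2 (fst Y)) := by
  refine (apply_eq_pullback_proj _ g _).trans ?_
  rw [pullback_proj_induced_fibreForm]
  refine (congrArg (c * ·) (fibreForm_apply g _)).trans ?_
  simp

theorem mfderiv_toLeft_projDeriv_eq_zero_iff {g v : CorrGroup} :
    (mfderiv 𝓘(ℝ, CorrGroup) 𝓘(ℝ, Heis) (toLeft k j) (proj (lattice k j) g) :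
      CorrGroup →L[ℝ] Heis) (projDeriv (Λ := lattice k j) g v) = 0 ↔ fst v = 0 := by
  rw [mfderiv_projDeriv ((contMDiff_toLeft k j).mdifferentiable (by simp)) (toLeft_comp_proj k j)]
  exact (projDeriv (Λ := Heis.lattice k) (fst g)).map_eq_zero_iff

theorem mfderiv_toRight_projDeriv_eq_zero_iff {g v : CorrGroup} :
    (mfderiv 𝓘(ℝ, CorrGroup) 𝓘(ℝ, Heis) (toRight k j) (proj (lattice k j) g) :
      CorrGroup →L[ℝ] Heis) (projDeriv (Λ := lattice k j) g v) = 0 ↔ snd v = 0 := by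
  rw [mfderiv_projDeriv ((contMDiff_toRight k j).mdifferentiable (by simp))
    (toRight_comp_proj k j)]
  exact (projDeriv (Λ := Heis.lattice j) (snd g)).map_eq_zero_iff

/-- `F` pairs a vector in the direction `∂_z` non-trivially with `∂_z'`. -/
theorem nondegenerate_left {c : ℝ} (hc : c ≠ 0) (w : HeisCorr k j)
    (X : TangentSpace 𝓘(ℝ, CorrGroup) w)
    (hX : mfderiv 𝓘(ℝ, CorrGroup) 𝓘(ℝ, Heis) (toRight k j) w X = 0)
    (h : ∀ Y : TangentSpace 𝓘(ℝ, CorrGroup) w,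
      mfderiv 𝓘(ℝ, CorrGroup) 𝓘(ℝ, Heis) (toLeft k j) w Y = 0 →
        DiffForm.induced (lattice k j) (c • fibreForm) w ![X, Y] = 0) : X = 0 := by
  obtain ⟨g, rfl⟩ := proj_surjective w
  obtain ⟨X, rfl⟩ := (projDeriv (Λ := lattice k j) g).surjective X
  have hX := (mfderiv_toRight_projDeriv_eq_zero_iff k j).1 hX
  have h1 := h (projDeriv (Λ := lattice k j) g (mk 0 0 0 1))
    ((mfderiv_toLeft_projDeriv_eq_zero_iff k j).2 rfl)
  have h2 := (induced_fibreForm_apply k j c g X (mk 0 0 0 1)).symm.trans h1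
  have hx : Heis.x (fst X) = 0 := congrArg Heis.x hX
  have hy : Heis.y (fst X) = 0 := congrArg Heis.y hX
  simp only [Heis.coframe_two, hX, hx, hy, fst_mk, snd_mk, map_zero, Heis.x_mk, Heis.y_mk,
    Heis.z_mk] at h2
  have hz : Heis.z (fst X) = 0 := by
    have h3 : c * Heis.z (fst X) = 0 := by linear_combination h2
    exact (mul_eq_zero.1 h3).resolve_left hc
  have hX0 : X = 0 := ext (Heis.ext hx hy hz) hX
  rw [hX0]
  exact map_zero (projDeriv (Λ := lattice k j) g)

/-- `F` pairs a vector in the direction `∂_z'` non-trivially with `∂_z`. -/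
theorem nondegenerate_right {c : ℝ} (hc : c ≠ 0) (w : HeisCorr k j)
    (Y : TangentSpace 𝓘(ℝ, CorrGroup) w)
    (hY : mfderiv 𝓘(ℝ, CorrGroup) 𝓘(ℝ, Heis) (toLeft k j) w Y = 0)
    (h : ∀ X : TangentSpace 𝓘(ℝ, CorrGroup) w,
      mfderiv 𝓘(ℝ, CorrGroup) 𝓘(ℝ, Heis) (toRight k j) w X = 0 →
        DiffForm.induced (lattice k j) (c • fibreForm) w ![X, Y] = 0) : Y = 0 := by
  obtain ⟨g, rfl⟩ := proj_surjective w
  obtain ⟨Y, rfl⟩ := (projDeriv (Λ := lattice k j) g).surjective Y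
  have hY := (mfderiv_toLeft_projDeriv_eq_zero_iff k j).1 hY
  have h1 := h (projDeriv (Λ := lattice k j) g (mk 0 0 1 0))
    ((mfderiv_toRight_projDeriv_eq_zero_iff k j).2 rfl)
  have h2 := (induced_fibreForm_apply k j c g (mk 0 0 1 0) Y).symm.trans h1
  have hx : Heis.x (snd Y) = 0 := congrArg Heis.x hY
  have hy : Heis.y (snd Y) = 0 := congrArg Heis.y hY
  simp only [Heis.coframe_two, hY, hx, hy, fst_mk, snd_mk, map_zero, Heis.x_mk, Heis.y_mk,
    Heis.z_mk] at h2
  have hz : Heis.z (snd Y) = 0 := by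
    have h3 : c * Heis.z (snd Y) = 0 := by linear_combination h2
    exact (mul_eq_zero.1 h3).resolve_left hc
  have hY0 : Y = 0 := ext hY (Heis.ext hx hy hz)
  rw [hY0]
  exact map_zero (projDeriv (Λ := lattice k j) g)

theorem pullback_sub_pullback_eq_d (c : ℝ) :
    (DiffForm.induced (Heis.lattice k) (c • Heis.vol)).pullback 𝓘(ℝ, CorrGroup) 𝓘(ℝ, Heis)
        (toLeft k j) -
      (DiffForm.induced (Heis.lattice j) (c • Heis.vol)).pullback 𝓘(ℝ, CorrGroup) 𝓘(ℝ, Heis)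
        (toRight k j) = (DiffForm.induced (lattice k j) (c • fibreForm)).d := by
  refine (d_eq_of_pullback (pullback_proj_induced_fibreForm k j c) ?_).symm
  have h1 := pullback_pullback_proj (DiffForm.induced (Heis.lattice k) (c • Heis.vol))
    ((contMDiff_toLeft k j).mdifferentiable (by simp))
    ((fst.contDiff (n := ∞)).contMDiff.mdifferentiable (by simp)) (toLeft_comp_proj k j)
  have h2 := pullback_pullback_proj (DiffForm.induced (Heis.lattice j) (c • Heis.vol))
    ((contMDiff_toRight k j).mdifferentiable (by simp))
    ((snd.contDiff (n := ∞)).contMDiff.mdifferentiable (by simp)) (toRight_comp_proj k j)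
  rw [Heis.pullback_proj_induced_vol] at h1 h2
  refine Eq.trans ?_ (extDeriv_smul_fibreForm c).symm
  rw [← h1, ← h2]
  rfl

end CorrGroup

/-- The pairs `(E_k, c ω₁ ∧ ω₂ ∧ ω₃)` and `(E_j, c ω₁ ∧ ω₂ ∧ ω₃)` are invariantly T-dual. -/
theorem HeisNil.tDualVia_vol (k j : ℕ+) {c : ℝ} (hc : c ≠ 0) :
    HeisNil.TDualVia k j (DiffForm.induced (Heis.lattice k) (c • Heis.vol))
      (DiffForm.induced (Heis.lattice j) (c • Heis.vol))
      (DiffForm.induced (CorrGroup.lattice k j) (c • CorrGroup.fibreForm)) where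
  nilmanifold₁ := Heis.isNilmanifold k
  nilmanifold₂ := Heis.isNilmanifold j
  nilmanifold := CorrGroup.isNilmanifold k j
  smooth_hom₁ := CorrGroup.fst.contDiff.contMDiff
  smooth_hom₂ := CorrGroup.snd.contDiff.contMDiff
  injective_hom _ _ h := CorrGroup.ext (congrArg Prod.fst h) (congrArg Prod.snd h)
  comm₁ _ := rfl
  comm₂ _ := rfl
  tDual :=
    { finrank_eq := rfl
      principal₁ := Heis.isPrincipalBundle k
      principal₂ := Heis.isPrincipalBundle j
      smooth₁ := Heis.isSmooth_induced_vol k c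
      smooth₂ := Heis.isSmooth_induced_vol j c
      closed₁ := Heis.d_induced_vol k c
      closed₂ := Heis.d_induced_vol j c
      torus_invariant₁ := Heis.circleAct_invariant_induced_vol k c
      torus_invariant₂ := Heis.circleAct_invariant_induced_vol j c
      fibreProduct := CorrGroup.isFibreProduct k j
      smooth := isSmooth_of_pullback (CorrGroup.contDiff_smul_fibreForm c)
        (CorrGroup.pullback_proj_induced_fibreForm k j c)
      torus_invariant := CorrGroup.induced_fibreForm_invariant k j c
      nondegenerate₁ := CorrGroup.nondegenerate_left k j hc
      nondegenerate₂ := CorrGroup.nondegenerate_right k j hc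
      d_eq := CorrGroup.pullback_sub_pullback_eq_d k j c }
  admissible₁ := Heis.isAdmissible_induced_vol k c
  admissible₂ := Heis.isAdmissible_induced_vol j c
  invariant₁ := by
    rw [Heis.pullback_proj_induced_vol]
    exact Heis.isLeftInvariant_vol.const_smul c
  invariant₂ := by
    rw [Heis.pullback_proj_induced_vol]
    exact Heis.isLeftInvariant_vol.const_smul c
  invariant := by
    rw [CorrGroup.pullback_proj_induced_fibreForm]
    exact CorrGroup.isLeftInvariant_fibreForm.const_smul c

end

theorem mainTheorem11 :
    (∀ H : DiffForm 𝓘(ℝ, Heis) Heis 3, H.IsLeftInvariant → H ≠ 0 →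
      (∀ k : ℕ+, (DiffForm.induced (Heis.lattice k) H).pullback 𝓘(ℝ, Heis) 𝓘(ℝ, Heis)
        (CosetSpace.proj (Heis.lattice k)) = H) ∧
      (∃ c : ℝ, c ≠ 0 ∧ H = c • Heis.vol ∧
        ∀ k j : ℕ+, HeisNil.TDualVia k j
          (DiffForm.induced (Heis.lattice k) H) (DiffForm.induced (Heis.lattice j) H)
          (DiffForm.induced (CorrGroup.lattice k j) (c • CorrGroup.fibreForm))) ∧
      (∀ k : ℕ+, ∃ S : Set ℕ+, S.Infinite ∧
        (∀ j ∈ S, ∃ F : DiffForm 𝓘(ℝ, CorrGroup) (HeisCorr k j) 2, HeisNil.TDualVia k j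
          (DiffForm.induced (Heis.lattice k) H) (DiffForm.induced (Heis.lattice j) H) F) ∧
        S.Pairwise fun i j =>
          IsEmpty (Diffeomorph 𝓘(ℝ, Heis) 𝓘(ℝ, Heis) (HeisNil i) (HeisNil j) ∞))) ∧
    (∀ i j : ℕ+, i ≠ j →
      IsEmpty (Heis.lattice i ≃* Heis.lattice j) ∧
      IsEmpty (Diffeomorph 𝓘(ℝ, Heis) 𝓘(ℝ, Heis) (HeisNil i) (HeisNil j) ∞)) := by
  refine ⟨fun H hH hH0 => ⟨fun k => CosetSpace.pullback_proj_induced hH, ?_⟩,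
    fun i j hij => ⟨⟨fun e => hij (Heis.eq_of_mulEquiv e)⟩, Heis.isEmpty_diffeomorph hij⟩⟩
  obtain ⟨c, rfl⟩ := Heis.exists_eq_smul_vol hH
  have hc : c ≠ 0 := by
    rintro rfl
    exact hH0 (zero_smul ℝ _)
  exact ⟨⟨c, hc, rfl, fun k j => HeisNil.tDualVia_vol k j hc⟩, fun k => ⟨Set.univ,
    Set.infinite_univ, fun j _ => ⟨_, HeisNil.tDualVia_vol k j hc⟩,
    fun i _ j _ hij => Heis.isEmpty_diffeomorph hij⟩⟩
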